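/- Let $s\ge 2$ be an integer, let $q$ be a prime power, let $\mathbb F_q$ be the finite field with $q$ elements, and fix a bijection $\varphi:\{0,\dots,q-1\}\to\mathbb F_q$ with $\varphi(0)=0$. For $m\in\mathbb N$ put $R_m=\mathbb F_q[x]/(x^m)$. For $i=1,\dots,s$ and all $m\in\mathbb N$ fix an ordered basis $\mathfrak B_{m,i}=\{\mathfrak b_{m,i,1},\dots,\mathfrak b_{m,i,m}\}$ of $R_m$ over $\mathbb F_q$ such that, in coordinates with respect to the canonical basis $1,x,x^2,\dots$, one has $\mathfrak b_{m+1,i,j}=(\mathfrak b_{m,i,j},0)$ for $1\le j\le m$. Let $\theta_m:R_m^s\to\mathbb F_q^{sm}$ map $(k_1,\dots,k_s)$ to the concatenation of the coordinate vectors of $k_i$ with respect to $\mathfrak B_{m,i}$, $i=1,\dots,s$. Let $Y$ be the set of all $\alpha\in\mathbb F_q[[x]]$ with $\gcd(\alpha \bmod x^m,\,x^m)=1$ for all $m\in\mathbb N$, and let $\widetilde Y^s=\{(\alpha_1,\dots,\alpha_s)\in Y^s:\alpha_1=1\}$. For $\boldsymbol\alpha\in Y^s$ let $\boldsymbol\alpha^{(m)}\in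 R_m^s$ be its coordinate-wise reduction modulo $x^m$, and let $\mathcal N_{\boldsymbol\alpha^{(m)}}=\theta_m(\{\mathbf k\in R_m^s:\boldsymbol\alpha^{(m)}\cdot\mathbf k=0\})\subseteq\mathbb F_q^{sm}$. Given $\mathbb N\times\mathbb N$ matrices $C_1,\dots,C_s$ over $\mathbb F_q$, the digital sequence generated by them is the sequence $(\boldsymbol x_k)_{k\ge0}$ with coordinates $x_{k,i}=\sum_{j\ge1}\varphi^{-1}(y_{i,j}(k))\,q^{-j}$, where $(y_{i,1}(k),y_{i,2}(k),\dots)^\top=C_i\,(\varphi(\kappa_0),\varphi(\kappa_1),\dots)^\top$ and $k=\kappa_0+\kappa_1q+\cdots$ is the $q$-adic expansion of $k$. Such a sequence is called a hyperplane sequence associated with $\boldsymbol\alpha\in Y^s$ if for every $m\in\mathbb N$ the row space of $(C_1^{(m)\top}\,\cdots\,C_s^{(m)\top})\in\mathbb F_q^{m\times sm}$, where $C_i^{(m)}$ is the upper left $m\times m$ submatrix of $C_i$, is the orthogonal complement of $\mathcal N_{\boldsymbol\alpha^{(m)}}$ in $\mathbb F_q^{sm}$. For a sequence $\mathcal S=(\boldsymbol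 x_n)_{n\ge0}$ and $N\in\mathbb N$ let $$D_N^*(\mathcal S)=\sup_{J}\left|\frac{\#\{0\le n<N:\boldsymbol x_n\in J\}}{N}-\lambda_s(J)\right|,$$ where the supremum is over all boxes $J=[0,a_1)\times\cdots\times[0,a_s)\subseteq[0,1)^s$ and $\lambda_s(J)$ is the volume of $J$. Then there is a constant $c$ depending only on $s$ and $q$ (not on $\varphi$, nor on the bases) and there is an $\boldsymbol\alpha\in\widetilde Y^s$ such that hyperplane sequences associated with $\boldsymbol\alpha$ exist and every hyperplane sequence $\mathcal S_{\boldsymbol\alpha}$ associated with $\boldsymbol\alpha$ satisfies $$D_N^*(\mathcal S_{\boldsymbol\alpha})\le c\,\frac{(\log N)^{2s}(\log\log N)^2}{N}\qquad\text{for all } N\ge 3.$$ -/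

import Mathlib

open Polynomial

noncomputable section

namespace HyperplaneSeq

/-! ### Star discrepancy -/

/-- The number of indices `n < N` for which `x n` lies in `[0, a₁) × ⋯ × [0, aₛ)`. -/
def boxCount {s : ℕ} (x : ℕ → Fin s → ℝ) (N : ℕ) (a : Fin s → ℝ) : ℕ :=
  Set.ncard {n : ℕ | n < N ∧ ∀ i, x n i ∈ Set.Ico 0 (a i)}

/-- Star discrepancy of the first `N` elements of the sequence `x`: the supremum, over all boxes
`[0, a₁) × ⋯ × [0, aₛ)` contained in the unit cube, of the difference between the relative number
of points in the box and the volume of the box. -/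
def starDiscrepancy {s : ℕ} (x : ℕ → Fin s → ℝ) (N : ℕ) : ℝ :=
  ⨆ a : Fin s → Set.Icc (0 : ℝ) 1,
    |(boxCount x N (fun i => (a i : ℝ)) : ℝ) / N - ∏ i, (a i : ℝ)|

/-- The supremum in `starDiscrepancy` is over a bounded family, so it is a true supremum. -/
theorem bddAbove_starDiscrepancy {s : ℕ} (x : ℕ → Fin s → ℝ) (N : ℕ) :
    BddAbove (Set.range fun a : Fin s → Set.Icc (0 : ℝ) 1 =>
      |(boxCount x N (fun i => (a i : ℝ)) : ℝ) / N - ∏ i, (a i : ℝ)|) := by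
  refine ⟨1, ?_⟩
  rintro _ ⟨a, rfl⟩
  have h1 : boxCount x N (fun i => (a i : ℝ)) ≤ N := by
    have h : boxCount x N (fun i => (a i : ℝ)) ≤ (Set.Iio N).ncard :=
      Set.ncard_le_ncard (fun n hn => hn.1) (Set.finite_Iio N)
    simpa [Set.ncard_eq_toFinset_card'] using h
  have h2 : (boxCount x N (fun i => (a i : ℝ)) : ℝ) / N ≤ 1 :=
    div_le_one_of_le₀ (by exact_mod_cast h1) (Nat.cast_nonneg N)
  have h3 : (0 : ℝ) ≤ (boxCount x N (fun i => (a i : ℝ)) : ℝ) / N := by positivity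
  have h4 : (0 : ℝ) ≤ ∏ i, (a i : ℝ) := Finset.prod_nonneg fun i _ => (a i).2.1
  have h5 : ∏ i, (a i : ℝ) ≤ 1 :=
    Finset.prod_le_one (fun i _ => (a i).2.1) (fun i _ => (a i).2.2)
  exact abs_le.2 ⟨by linarith, by linarith⟩

/-! ### Digital sequences -/

/-- Entry `j` of the product of the `ℕ × ℕ` matrix `C` with the digit vector
`(φ κ₀, φ κ₁, …)` of `k = κ₀ + κ₁ q + ⋯`. The sum is finite because `φ 0 = 0`: only the positions
below the length of the `q`-adic expansion of `k` contribute. -/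
def outputDigit {F : Type*} [Field F] {q : ℕ} [NeZero q] (φ : Fin q ≃ F)
    (C : Matrix ℕ ℕ F) (k j : ℕ) : F :=
  ∑ r ∈ Finset.range (Nat.digits q k).length, C j r * φ (Fin.ofNat q (k / q ^ r))

/-- The digital sequence with generating matrices `C₁, …, Cₛ` (rows and columns numbered from
`0`): coordinate `i` of point `k` is `∑ⱼ φ⁻¹(yᵢⱼ(k)) q^{-(j+1)}`. -/
def digitalSequence {F : Type*} [Field F] {q s : ℕ} [NeZero q] (φ : Fin q ≃ F)
    (C : Fin s → Matrix ℕ ℕ F) (k : ℕ) (i : Fin s) : ℝ :=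
  Real.ofDigits fun j => φ.symm (outputDigit φ (C i) k j)

/-- The row space in `F^{sm}` of the `m`-th overall generating matrix
`(C₁^{(m)ᵀ} ⋯ Cₛ^{(m)ᵀ})`, where `Cᵢ^{(m)}` is the upper left `m × m` submatrix of `Cᵢ`. -/
def rowSpace {F : Type*} [Field F] {s : ℕ} (C : Fin s → Matrix ℕ ℕ F) (m : ℕ) :
    Submodule F (Fin s × Fin m → F) :=
  Submodule.span F (Set.range fun (r : Fin m) (p : Fin s × Fin m) => C p.1 p.2 r)

/-- Orthogonal complement for the standard inner product on `F^ι`. -/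
def orth {F ι : Type*} [Field F] [Fintype ι] (V : Submodule F (ι → F)) :
    Submodule F (ι → F) where
  carrier := {A | ∀ B ∈ V, B ⬝ᵥ A = 0}
  add_mem' := fun {A A'} hA hA' B hB => by rw [dotProduct_add, hA B hB, hA' B hB, add_zero]
  zero_mem' := fun B _ => dotProduct_zero B
  smul_mem' := fun c A hA B hB => by rw [dotProduct_smul, hA B hB, smul_zero]

/-! ### Hyperplane sequences -/

/-- The residue class ring `R_m = F[x] / (x^m)`. -/
abbrev ResRing (F : Type*) [Field F] (m : ℕ) : Type _ := AdjoinRoot (X ^ m : F[X])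

/-- The representative of degree `< m` of a residue class modulo `x^m`; its coefficients are the
coordinates with respect to the canonical basis `1, x, …, x^{m-1}`. -/
def canonicalRep (F : Type*) [Field F] (m : ℕ) : ResRing F m →ₗ[F] F[X] :=
  AdjoinRoot.modByMonicHom (monic_X_pow m)

/-- A choice, for every `i = 1, …, s` and every `m`, of an ordered basis of `R_m` over `F` such
that in canonical coordinates the `j`-th vector of basis number `m + 1`, for `j ≤ m`, is the
`j`-th vector of basis number `m` with a `0` appended. (For `m = 0` the ring is trivial and the
basis is empty.) -/
structure NestedBases (F : Type*) [Field F] (s : ℕ) where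
  basis : ∀ (m : ℕ) (_ : Fin s), Module.Basis (Fin m) F (ResRing F m)
  nested : ∀ (m : ℕ) (i : Fin s) (j : Fin m),
    canonicalRep F (m + 1) (basis (m + 1) i j.castSucc) = canonicalRep F m (basis m i j)

/-- The reduction modulo `x^m` of a formal power series, as an element of `R_m`. -/
def reduction {F : Type*} [Field F] (m : ℕ) (α : PowerSeries F) : ResRing F m :=
  AdjoinRoot.mk (X ^ m : F[X]) (PowerSeries.trunc m α)

/-- The set `Y` of formal power series `α` with `gcd(α mod x^m, x^m) = 1` for all `m ≥ 1`. -/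
def Y (F : Type*) [Field F] : Set (PowerSeries F) :=
  {α | ∀ m : ℕ, 1 ≤ m → IsCoprime (PowerSeries.trunc m α) (X ^ m : F[X])}

/-- The set `Ỹˢ` of all `(α₁, …, αₛ) ∈ Yˢ` with `α₁ = 1`; the first index is `0 : Fin s`. -/
def YTilde (F : Type*) [Field F] (s : ℕ) : Set (Fin s → PowerSeries F) :=
  {α | (∀ i, α i ∈ Y F) ∧ ∀ i : Fin s, (i : ℕ) = 0 → α i = 1}

/-- The space of all `k ∈ R_m^s` with `α^{(m)} · k ≡ 0 (mod x^m)`. -/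
def hyperplane {F : Type*} [Field F] {s : ℕ} (α : Fin s → PowerSeries F) (m : ℕ) :
    Submodule F (Fin s → ResRing F m) where
  carrier := {k | ∑ i, reduction m (α i) * k i = 0}
  add_mem' := fun {k l} hk hl => by
    simp only [Set.mem_ofPred_eq, Pi.add_apply, mul_add, Finset.sum_add_distrib] at *
    rw [hk, hl, add_zero]
  zero_mem' := by simp
  smul_mem' := fun c k hk => by
    simp only [Set.mem_ofPred_eq, Pi.smul_apply, mul_smul_comm, ← Finset.smul_sum] at *
    rw [hk, smul_zero]

/-- The map `θ_m : R_m^s → F^{sm}` taking coordinates with respect to the chosen bases. -/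
def theta {F : Type*} [Field F] {s : ℕ} (𝔅 : NestedBases F s) (m : ℕ) :
    (Fin s → ResRing F m) →ₗ[F] (Fin s × Fin m → F) where
  toFun k p := (𝔅.basis m p.1).repr (k p.1) p.2
  map_add' k l := by ext p; simp
  map_smul' c k := by ext p; simp

/-- The `m`-th member `𝒩_{α^{(m)}} ⊆ F^{sm}` of the dual space chain belonging to `α`. -/
def dualSpace {F : Type*} [Field F] {s : ℕ} (𝔅 : NestedBases F s)
    (α : Fin s → PowerSeries F) (m : ℕ) : Submodule F (Fin s × Fin m → F) :=
  (hyperplane α m).map (theta 𝔅 m)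

/-- `C₁, …, Cₛ` are generating matrices of a hyperplane sequence associated with `α`: for every
`m ≥ 1` the row space of the `m`-th overall generating matrix is the orthogonal complement of the
`m`-th space of the dual space chain of `α`. -/
def IsHyperplaneGenerating {F : Type*} [Field F] {s : ℕ} (𝔅 : NestedBases F s)
    (α : Fin s → PowerSeries F) (C : Fin s → Matrix ℕ ℕ F) : Prop :=
  ∀ m : ℕ, 1 ≤ m → rowSpace C m = orth (dualSpace 𝔅 α m)

/-- `x` is a hyperplane sequence associated with `α`. -/
def IsHyperplaneSequence {F : Type*} [Field F] {q s : ℕ} [NeZero q] (φ : Fin q ≃ F)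
    (𝔅 : NestedBases F s) (α : Fin s → PowerSeries F) (x : ℕ → Fin s → ℝ) : Prop :=
  ∃ C : Fin s → Matrix ℕ ℕ F, IsHyperplaneGenerating 𝔅 α C ∧ x = digitalSequence φ C

end HyperplaneSeq

end

/-!
# Hyperplane sequences with small star discrepancy

Call a tuple `k` of polynomials with `deg (k i) < d i` a solution at level `m` if
`α · k ≡ 0 (mod x ^ m)`. In a block of `q ^ m` consecutive points of a hyperplane sequence, lying
in an elementary box with sides `q ^ (-d i)` means solving a linear system with `∑ d` equations in
the `m` lowest digits of the index. The left kernel of that system embeds into the solutions,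
because the coordinate vectors orthogonal to the row space form the dual space and the nested
bases are compatible with degrees (`card_leftKer_le`). Equality of row and column rank then shows
that the number of points differs from the expected `q ^ (m - ∑ d)` by at most `q ^ (m - ∑ d)`
times the number of nonzero solutions (`abs_card_solutions_sub_le`). Decomposing a box into
elementary boxes and an initial segment of the sequence into aligned blocks bounds the discrepancy
by the sum over `m ≤ log N / log q` of `defect α m`, the total of these errors over all shapes `d`
(`starDiscrepancy_le`).

It remains to choose `α` with small defects at all levels. If `k` is a nonzero solution, some
component `k i` with `i ≠ 0` is nonzero, since `α` has first component `1`; if its order is `v`,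
then `α i` is determined modulo `x ^ (m - v)` by the other components. So a random `α` with
constant coefficients `1` solves the congruence for `k` with probability at most `q ^ (1 + v - m)`,
while at most the fraction `q ^ (-v)` of all `k` has a component `k i` of order `v`. Hence the
average defect at level `m` is `O(m ^ (s + 1))` (`sum_defect_le`). Weighting the defects
by `1 / (m ^ (s + 2) log² m)` makes the sum of the averages converge, so for every `M` some `α` has
a bounded weighted sum of the defects below `M`; compactness gives one `α` for all `M`
(`exists_coeffs_forall_sum_weight_mul_defect_le`). The partial sums of its defects up to
`n ≍ log N` are `O(n ^ (s + 2) log² n)`, and `s + 2 ≤ 2 s`.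
-/

noncomputable section

namespace HyperplaneSeq

/-! ### Linear systems over a finite field and their left kernels -/

section LinearAlgebra

variable {F : Type*} [Field F]

/-- The rank of a matrix equals that of its transpose; in terms of cardinalities, the kernel and
the left kernel determine each other. -/
theorem card_ker_mul_pow [Fintype F] {D n : Type*} [Fintype D] [Fintype n] (G : Matrix D n F) :
    Nat.card {x : n → F // G.mulVec x = 0} * Fintype.card F ^ Fintype.card D =
      Fintype.card F ^ Fintype.card n * Nat.card {u : D → F // Matrix.vecMul u G = 0} := by
  classical
  have h1 : Nat.card {x : n → F // G.mulVec x = 0} =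
      Fintype.card F ^ Module.finrank F (LinearMap.ker G.mulVecLin) := by
    rw [← Nat.card_eq_fintype_card, ← Module.natCard_eq_pow_finrank]
    rfl
  have h2 : Nat.card {u : D → F // Matrix.vecMul u G = 0} =
      Fintype.card F ^ Module.finrank F (LinearMap.ker G.transpose.mulVecLin) := by
    rw [← Nat.card_eq_fintype_card, ← Module.natCard_eq_pow_finrank]
    refine Nat.card_congr (Equiv.subtypeEquivRight fun u => ?_)
    rw [LinearMap.mem_ker, Matrix.mulVecLin_apply, Matrix.mulVec_transpose]
  have h3 := LinearMap.finrank_range_add_finrank_ker G.mulVecLin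
  have h4 := LinearMap.finrank_range_add_finrank_ker G.transpose.mulVecLin
  have h5 : Module.finrank F (LinearMap.range G.transpose.mulVecLin) =
      Module.finrank F (LinearMap.range G.mulVecLin) := Matrix.rank_transpose G
  rw [Module.finrank_fintype_fun_eq_card] at h3 h4
  rw [h1, h2, ← pow_add, ← pow_add]
  congr 1
  omega

/-- A system `G x = c` has about `q^{n - D}` solutions, the error being controlled by the size of
the left kernel of `G`: if the left kernel is trivial there is no error at all, and otherwise the
number of solutions is `0` or the size of the kernel. -/
theorem abs_card_solutions_sub_le [Fintype F] {D n : Type*} [Fintype D] [Fintype n]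
    (G : Matrix D n F) (c : D → F) :
    |(Nat.card {x : n → F // G.mulVec x = c} : ℝ) -
        (Fintype.card F : ℝ) ^ Fintype.card n / (Fintype.card F : ℝ) ^ Fintype.card D| ≤
      (Fintype.card F : ℝ) ^ Fintype.card n / (Fintype.card F : ℝ) ^ Fintype.card D *
        ((Nat.card {u : D → F // Matrix.vecMul u G = 0} : ℝ) - 1) := by
  classical
  have hq : (0 : ℝ) < Fintype.card F := by exact_mod_cast Fintype.card_pos
  set Q : ℝ := (Fintype.card F : ℝ) ^ Fintype.card n / (Fintype.card F : ℝ) ^ Fintype.card D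
    with hQ
  have hQ0 : 0 < Q := by positivity
  set K := Nat.card {x : n → F // G.mulVec x = 0} with hK
  set L := Nat.card {u : D → F // Matrix.vecMul u G = 0} with hL
  have hKL : (K : ℝ) = Q * L := by
    have h := card_ker_mul_pow G
    rw [← hK, ← hL] at h
    have h' : (K : ℝ) * (Fintype.card F : ℝ) ^ Fintype.card D =
        (Fintype.card F : ℝ) ^ Fintype.card n * L := by exact_mod_cast h
    rw [hQ]
    field_simp
    exact h'
  have hLpos : 0 < L := by
    have : Nonempty {u : D → F // Matrix.vecMul u G = 0} := ⟨⟨0, Matrix.zero_vecMul G⟩⟩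
    exact Nat.card_pos
  by_cases hc : ∃ x₀, G.mulVec x₀ = c
  · obtain ⟨x₀, hx₀⟩ := hc
    have hcard : Nat.card {x : n → F // G.mulVec x = c} = K := by
      refine Nat.card_congr ((Equiv.subRight x₀).subtypeEquiv fun x => ?_)
      rw [Equiv.subRight_apply, Matrix.mulVec_sub, hx₀, sub_eq_zero]
    have hL1 : (1 : ℝ) ≤ L := by exact_mod_cast hLpos
    rw [hcard, hKL, abs_of_nonneg (by nlinarith)]
    linarith
  · have hcard : Nat.card {x : n → F // G.mulVec x = c} = 0 := by
      have : IsEmpty {x : n → F // G.mulVec x = c} := ⟨fun x => hc ⟨x.1, x.2⟩⟩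
      exact Nat.card_of_isEmpty
    -- No solution means that the rank of `G` is not full, so that the left kernel is nontrivial.
    have hL2 : 2 ≤ L := by
      by_contra hlt
      have hL1 : L = 1 := by omega
      apply hc
      have hsub : Subsingleton {u : D → F // Matrix.vecMul u G = 0} :=
        (Nat.card_eq_one_iff_unique.1 hL1).1
      have hker : LinearMap.ker G.transpose.mulVecLin = ⊥ := by
        rw [LinearMap.ker_eq_bot']
        intro u hu
        rw [Matrix.mulVecLin_apply, Matrix.mulVec_transpose] at hu
        exact congrArg Subtype.val
          (hsub.elim ⟨u, hu⟩ ⟨0, Matrix.zero_vecMul G⟩)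
      have h4 := LinearMap.finrank_range_add_finrank_ker G.transpose.mulVecLin
      rw [hker, finrank_bot, add_zero] at h4
      have h5 : Module.finrank F (LinearMap.range G.transpose.mulVecLin) =
          Module.finrank F (LinearMap.range G.mulVecLin) := Matrix.rank_transpose G
      have htop : LinearMap.range G.mulVecLin = ⊤ :=
        Submodule.eq_top_of_finrank_eq (by rw [← h5, h4])
      have hmem : c ∈ LinearMap.range G.mulVecLin := by rw [htop]; trivial
      obtain ⟨x, hx⟩ := hmem
      exact ⟨x, hx⟩
    have hL2' : (2 : ℝ) ≤ L := by exact_mod_cast hL2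
    rw [hcard, Nat.cast_zero, zero_sub, abs_neg, abs_of_pos hQ0]
    nlinarith

theorem orth_orth {ι : Type*} [Fintype ι] (V : Submodule F (ι → F)) : orth (orth V) = V := by
  classical
  let B : LinearMap.BilinForm F (ι → F) := dotProductBilin F F
  have hB : ∀ x y, B x y = x ⬝ᵥ y := fun _ _ => rfl
  have hrefl : B.IsRefl := fun x y h => by rw [hB, dotProduct_comm]; exact h
  have hnd : B.Nondegenerate := by
    refine (LinearMap.IsRefl.nondegenerate_iff_separatingLeft hrefl).2 fun x hx => ?_
    exact dotProduct_eq_zero x fun y => hx y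
  have horth : ∀ W : Submodule F (ι → F), orth W = B.orthogonal W := fun W => rfl
  rw [horth, horth]
  exact LinearMap.BilinForm.orthogonal_orthogonal hnd hrefl V

end LinearAlgebra

/-! ### The dual space chain in terms of polynomials -/

section Dual

variable {F : Type*} [Field F] {s : ℕ}

theorem degree_canonicalRep_lt (m : ℕ) (k : ResRing F m) :
    (canonicalRep F m k).degree < m := by
  obtain ⟨p, rfl⟩ := AdjoinRoot.mk_surjective k
  rw [canonicalRep, AdjoinRoot.modByMonicHom_mk]
  exact (degree_modByMonic_lt _ (monic_X_pow m)).trans_eq (degree_X_pow m)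

theorem mk_canonicalRep (m : ℕ) (k : ResRing F m) :
    AdjoinRoot.mk (X ^ m : F[X]) (canonicalRep F m k) = k :=
  AdjoinRoot.mk_leftInverse (monic_X_pow m) k

theorem canonicalRep_injective (m : ℕ) : Function.Injective (canonicalRep F m) :=
  (AdjoinRoot.mk_leftInverse (monic_X_pow m)).injective

/-- The polynomial of degree at most `j` that represents the `j`-th vector of every basis in the
`i`-th nested family; see `canonicalRep_basis`. -/
def basisPoly (𝔅 : NestedBases F s) (i : Fin s) (j : ℕ) : F[X] :=
  canonicalRep F (j + 1) (𝔅.basis (j + 1) i (Fin.last j))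

theorem canonicalRep_basis (𝔅 : NestedBases F s) (m : ℕ) (i : Fin s) (j : Fin m) :
    canonicalRep F m (𝔅.basis m i j) = basisPoly 𝔅 i j := by
  induction m with
  | zero => exact j.elim0
  | succ n ih =>
    induction j using Fin.lastCases with
    | last => rfl
    | cast j => rw [𝔅.nested, ih, Fin.val_castSucc]

/-- The polynomial of degree less than `m` whose class in the `i`-th copy of `R_m` has the
coordinates `A (i, ·)`. -/
def ofCoords (𝔅 : NestedBases F s) (m : ℕ) (A : Fin s × Fin m → F) (i : Fin s) : F[X] :=
  ∑ j : Fin m, A (i, j) • basisPoly 𝔅 i j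

theorem canonicalRep_sum_smul_basis (𝔅 : NestedBases F s) (m : ℕ) (A : Fin s × Fin m → F)
    (i : Fin s) :
    canonicalRep F m (∑ j : Fin m, A (i, j) • 𝔅.basis m i j) = ofCoords 𝔅 m A i := by
  simp only [map_sum, map_smul, canonicalRep_basis, ofCoords]

theorem ofCoords_injective (𝔅 : NestedBases F s) (m : ℕ) :
    Function.Injective (ofCoords 𝔅 m) := by
  intro A B h
  ext ⟨i, j⟩
  have h1 := congrFun h i
  rw [← canonicalRep_sum_smul_basis, ← canonicalRep_sum_smul_basis] at h1
  have h2 := congrArg (fun v => (𝔅.basis m i).repr v j) (canonicalRep_injective m h1)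
  simpa only [Module.Basis.repr_sum_self] using h2

theorem mem_hyperplane_iff (α : Fin s → PowerSeries F) (m : ℕ) (k : Fin s → ResRing F m) :
    k ∈ hyperplane α m ↔
      (PowerSeries.X : PowerSeries F) ^ m ∣ ∑ i, α i * (canonicalRep F m (k i) : F[X]) := by
  have h1 : k ∈ hyperplane α m ↔
      (X : F[X]) ^ m ∣ ∑ i, PowerSeries.trunc m (α i) * canonicalRep F m (k i) := by
    rw [← AdjoinRoot.mk_eq_zero, map_sum]
    simp only [map_mul, mk_canonicalRep]
    rfl
  have h2 : (PowerSeries.X : PowerSeries F) ^ m ∣ ∑ i, α i * (canonicalRep F m (k i) : F[X]) -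
      ((∑ i, PowerSeries.trunc m (α i) * canonicalRep F m (k i) : F[X]) : PowerSeries F) := by
    rw [← Polynomial.coeToPowerSeries.ringHom_apply, map_sum, ← Finset.sum_sub_distrib]
    refine Finset.dvd_sum fun i _ => ?_
    rw [map_mul, Polynomial.coeToPowerSeries.ringHom_apply,
      Polynomial.coeToPowerSeries.ringHom_apply, ← sub_mul]
    refine Dvd.dvd.mul_right ?_ _
    rw [PowerSeries.X_pow_dvd_iff]
    intro r hr
    rw [map_sub, Polynomial.coeff_coe, PowerSeries.coeff_trunc, if_pos hr, sub_self]
  rw [h1, Polynomial.X_pow_dvd_iff, dvd_iff_dvd_of_dvd_sub h2, PowerSeries.X_pow_dvd_iff]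
  simp only [Polynomial.coeff_coe]

theorem mem_dualSpace_iff (𝔅 : NestedBases F s) (α : Fin s → PowerSeries F) (m : ℕ)
    (A : Fin s × Fin m → F) :
    A ∈ dualSpace 𝔅 α m ↔
      (PowerSeries.X : PowerSeries F) ^ m ∣ ∑ i, α i * (ofCoords 𝔅 m A i : F[X]) := by
  have key : (fun i => ∑ j : Fin m, A (i, j) • 𝔅.basis m i j) ∈ hyperplane α m ↔
      (PowerSeries.X : PowerSeries F) ^ m ∣ ∑ i, α i * (ofCoords 𝔅 m A i : F[X]) := by
    rw [mem_hyperplane_iff]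
    simp only [canonicalRep_sum_smul_basis]
  rw [← key, dualSpace, Submodule.mem_map]
  constructor
  · rintro ⟨k, hk, rfl⟩
    convert hk using 1
    ext1 i
    exact (𝔅.basis m i).sum_repr (k i)
  · intro h
    refine ⟨_, h, ?_⟩
    ext ⟨i, j⟩
    simp only [theta, LinearMap.coe_mk, AddHom.coe_mk, Module.Basis.repr_sum_self]

theorem mem_orth_rowSpace_iff (C : Fin s → Matrix ℕ ℕ F) (m : ℕ) (A : Fin s × Fin m → F) :
    A ∈ orth (rowSpace C m) ↔ ∀ r : Fin m, ∑ p : Fin s × Fin m, C p.1 p.2 r * A p = 0 := by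
  constructor
  · intro h r
    exact h _ (Submodule.subset_span ⟨r, rfl⟩)
  · intro h B hB
    induction hB using Submodule.span_induction with
    | mem B hB =>
      obtain ⟨r, rfl⟩ := hB
      exact h r
    | zero => exact zero_dotProduct A
    | add B B' _ _ h1 h2 => rw [add_dotProduct, h1, h2, add_zero]
    | smul c B _ h1 => rw [smul_dotProduct, h1, smul_zero]

/-- Generating matrices exist for every `α`: the entry of the `i`-th matrix at `(j, r)` is the
`r`-th coefficient of `α i` times the `j`-th basis polynomial, so that the `r`-th column expresses
the vanishing of the `r`-th coefficient of `α · k`. -/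
theorem exists_isHyperplaneGenerating (𝔅 : NestedBases F s) (α : Fin s → PowerSeries F) :
    ∃ C : Fin s → Matrix ℕ ℕ F, IsHyperplaneGenerating 𝔅 α C := by
  let C : Fin s → Matrix ℕ ℕ F := fun i =>
    Matrix.of fun j r => PowerSeries.coeff r (α i * ((basisPoly 𝔅 i j : F[X]) : PowerSeries F))
  refine ⟨C, fun m _ => ?_⟩
  rw [← orth_orth (rowSpace C m)]
  congr 1
  ext A
  have hcoeff : ∀ r, PowerSeries.coeff r
      (∑ i, α i * ((ofCoords 𝔅 m A i : F[X]) : PowerSeries F)) =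
      ∑ p : Fin s × Fin m, C p.1 p.2 r * A p := by
    intro r
    rw [map_sum, Fintype.sum_prod_type]
    refine Finset.sum_congr rfl fun i _ => ?_
    rw [ofCoords, ← Polynomial.coeToPowerSeries.ringHom_apply, map_sum, Finset.mul_sum, map_sum]
    refine Finset.sum_congr rfl fun j _ => ?_
    rw [Polynomial.coeToPowerSeries.ringHom_apply, Polynomial.coe_smul, mul_smul_comm,
      PowerSeries.coeff_smul, smul_eq_mul]
    exact mul_comm _ _
  rw [mem_dualSpace_iff, mem_orth_rowSpace_iff, PowerSeries.X_pow_dvd_iff]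
  simp only [hcoeff]
  exact ⟨fun h r hr => h ⟨r, hr⟩, fun h r => h r r.2⟩

/-- The polynomial of degree less than `d i` with coefficients `k ⟨i, ·⟩`. -/
def polyOf (d : Fin s → ℕ) (k : (Σ i, Fin (d i)) → F) (i : Fin s) : F[X] :=
  ∑ j : Fin (d i), monomial (j : ℕ) (k ⟨i, j⟩)

/-- The tuples of polynomials `k` with `deg (k i) < d i`, given by their coefficients, that solve
`α · k ≡ 0 (mod x ^ m)`. -/
def solutions (α : Fin s → PowerSeries F) (m : ℕ) (d : Fin s → ℕ) :
    Set ((Σ i, Fin (d i)) → F) :=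
  {k | (PowerSeries.X : PowerSeries F) ^ m ∣ ∑ i, α i * (polyOf d k i : F[X])}

theorem coeff_polyOf (d : Fin s → ℕ) (k : (Σ i, Fin (d i)) → F) (i : Fin s) (r : ℕ) :
    (polyOf d k i).coeff r = if h : r < d i then k ⟨i, r, h⟩ else 0 := by
  rw [polyOf, finsetSum_coeff]
  simp only [coeff_monomial]
  split_ifs with h
  · rw [Finset.sum_eq_single ⟨r, h⟩]
    · simp
    · intro j _ hj
      exact if_neg fun h' => hj (Fin.ext h')
    · simp
  · exact Finset.sum_eq_zero fun j _ => if_neg fun h' => h (by omega)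

theorem polyOf_coeff (d : Fin s → ℕ) (p : Fin s → F[X]) (i : Fin s) (hp : (p i).degree < d i) :
    polyOf d (fun x => (p x.1).coeff x.2) i = p i := by
  ext r
  rw [coeff_polyOf]
  split_ifs with h
  · rfl
  · refine (coeff_eq_zero_of_degree_lt (hp.trans_le ?_)).symm
    exact_mod_cast not_lt.1 h

/-- Extension by zero of a vector indexed by the first `d i` positions in each of `s` blocks of
length `m`. -/
def extendZero (d : Fin s → ℕ) (m : ℕ) (u : (Σ i, Fin (d i)) → F) (p : Fin s × Fin m) : F :=
  if h : (p.2 : ℕ) < d p.1 then u ⟨p.1, p.2, h⟩ else 0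

theorem sum_mul_extendZero {d : Fin s → ℕ} {m : ℕ} (hd : ∀ i, d i ≤ m)
    (f : Fin s → ℕ → F) (u : (Σ i, Fin (d i)) → F) :
    ∑ p : Fin s × Fin m, f p.1 p.2 * extendZero d m u p =
      ∑ p : Σ i, Fin (d i), f p.1 p.2 * u p := by
  rw [Fintype.sum_prod_type, Fintype.sum_sigma]
  refine Finset.sum_congr rfl fun i _ => ?_
  symm
  refine Fintype.sum_of_injective (Fin.castLE (hd i)) (Fin.castLE_injective _) _ _ ?_ ?_
  · intro j hj
    have : ¬ (j : ℕ) < d i := fun h => hj ⟨⟨j, h⟩, Fin.ext rfl⟩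
    simp [extendZero, this]
  · intro j
    simp [extendZero]

theorem degree_basisPoly_lt (𝔅 : NestedBases F s) (i : Fin s) (j : ℕ) :
    (basisPoly 𝔅 i j).degree < (j + 1 : ℕ) :=
  degree_canonicalRep_lt _ _

theorem degree_ofCoords_extendZero_lt (𝔅 : NestedBases F s) (m : ℕ) (d : Fin s → ℕ)
    (u : (Σ i, Fin (d i)) → F) (i : Fin s) :
    (ofCoords 𝔅 m (extendZero d m u) i).degree < d i := by
  rw [← mem_degreeLT, ofCoords]
  refine Submodule.sum_mem _ fun j _ => ?_
  by_cases h : (j : ℕ) < d i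
  · refine Submodule.smul_mem _ _ (mem_degreeLT.2 ?_)
    refine (degree_basisPoly_lt 𝔅 i j).trans_le ?_
    exact_mod_cast h
  · simp [extendZero, h]

/-- The left kernel of the system formed by the first `d i` rows of each generating matrix embeds
into the solutions of `α · k ≡ 0 (mod x ^ m)` with `deg (k i) < d i`. As the bases are nested, the
coordinates of a residue class and its canonical coefficients have the same leading position, so
that the choice of bases does not matter here. -/
theorem card_leftKer_le [Finite F] {𝔅 : NestedBases F s} {α : Fin s → PowerSeries F}
    {C : Fin s → Matrix ℕ ℕ F} {m : ℕ} (hC : rowSpace C m = orth (dualSpace 𝔅 α m))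
    {d : Fin s → ℕ} (hd : ∀ i, d i ≤ m) :
    Nat.card {u : (Σ i, Fin (d i)) → F //
        Matrix.vecMul u (Matrix.of fun p (r : Fin m) => C p.1 p.2 r) = 0} ≤
      Nat.card (solutions α m d) := by
  have hpoly : ∀ u : (Σ i, Fin (d i)) → F, ∀ i,
      polyOf d (fun x => (ofCoords 𝔅 m (extendZero d m u) x.1).coeff x.2) i =
        ofCoords 𝔅 m (extendZero d m u) i :=
    fun u i => polyOf_coeff d _ i (degree_ofCoords_extendZero_lt 𝔅 m d u i)
  refine Nat.card_le_card_of_injective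
    (fun u => ⟨fun x => (ofCoords 𝔅 m (extendZero d m u.1) x.1).coeff x.2, ?_⟩) ?_
  · change (PowerSeries.X : PowerSeries F) ^ m ∣ _
    simp only [hpoly]
    rw [← mem_dualSpace_iff, ← orth_orth (dualSpace 𝔅 α m), ← hC, mem_orth_rowSpace_iff]
    intro r
    rw [sum_mul_extendZero hd (fun i j => C i j r)]
    have h := congrFun u.2 r
    simp only [Matrix.vecMul, dotProduct, Matrix.of_apply, Pi.zero_apply] at h
    rw [← h]
    exact Finset.sum_congr rfl fun p _ => mul_comm _ _
  · intro u v huv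
    have h1 : ofCoords 𝔅 m (extendZero d m u.1) = ofCoords 𝔅 m (extendZero d m v.1) := by
      ext1 i
      rw [← hpoly, ← hpoly]
      exact congrArg (fun k => polyOf d k i) (congrArg Subtype.val huv)
    have h2 := ofCoords_injective 𝔅 m h1
    refine Subtype.ext (funext fun p => ?_)
    have h3 := congrFun h2 (p.1, ⟨p.2, p.2.2.trans_le (hd p.1)⟩)
    simpa [extendZero] using h3

end Dual

/-! ### Counting points in boxes through elementary boxes -/

section Digits

/-- The integer with base-`q` digits `δ 0, …, δ (m - 1)`, most significant digit first. -/
def prefixNat {q : ℕ} (δ : ℕ → Fin q) : ℕ → ℕ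
  | 0 => 0
  | m + 1 => q * prefixNat δ m + δ m

theorem prefixNat_lt {q : ℕ} (δ : ℕ → Fin q) (m : ℕ) : prefixNat δ m < q ^ m := by
  induction m with
  | zero => simp [prefixNat]
  | succ m ih =>
    have h := (δ m).2
    rw [prefixNat, pow_succ]
    nlinarith

theorem prefixNat_add_div {q : ℕ} (δ : ℕ → Fin q) (d e : ℕ) :
    prefixNat δ (d + e) / q ^ e = prefixNat δ d := by
  have hq : 0 < q := (δ 0).pos
  induction e with
  | zero => simp
  | succ e ih =>
    rw [pow_succ', ← Nat.div_div_eq_div_mul, ← add_assoc, prefixNat, Nat.mul_add_div hq,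
      Nat.div_eq_of_lt (δ (d + e)).2, add_zero, ih]

theorem exists_prefixNat_eq_iff {q : ℕ} (hq : 0 < q) (d t : ℕ) (ht : t < q ^ d) :
    ∃ τ : ℕ → Fin q, ∀ δ : ℕ → Fin q, prefixNat δ d = t ↔ ∀ j < d, δ j = τ j := by
  induction d generalizing t with
  | zero =>
    refine ⟨fun _ => ⟨0, hq⟩, fun δ => ?_⟩
    have : t = 0 := by simpa using ht
    simp [prefixNat, this]
  | succ d ih =>
    obtain ⟨τ, hτ⟩ := ih (t / q) (by
      rw [Nat.div_lt_iff_lt_mul hq, ← pow_succ]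
      exact ht)
    refine ⟨Function.update τ d ⟨t % q, Nat.mod_lt _ hq⟩, fun δ => ?_⟩
    have h1 : prefixNat δ (d + 1) = t ↔ prefixNat δ d = t / q ∧ (δ d : ℕ) = t % q := by
      have hδ := (δ d).2
      rw [prefixNat]
      constructor
      · rintro rfl
        rw [Nat.mul_add_div hq, Nat.div_eq_of_lt hδ, Nat.mul_add_mod, Nat.mod_eq_of_lt hδ]
        exact ⟨rfl, rfl⟩
      · rintro ⟨h1, h2⟩
        rw [h1, h2]
        exact Nat.div_add_mod t q
    rw [h1, hτ]
    constructor
    · rintro ⟨h2, h3⟩ j hj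
      rcases Nat.lt_succ_iff_lt_or_eq.1 hj with hj | rfl
      · rw [Function.update_of_ne hj.ne, h2 j hj]
      · rw [Function.update_self]
        exact Fin.ext h3
    · intro h2
      refine ⟨fun j hj => ?_, ?_⟩
      · rw [h2 j (by omega), Function.update_of_ne hj.ne]
      · rw [h2 d (by omega), Function.update_self]

theorem prefixNat_eq_sum {q : ℕ} (δ : ℕ → Fin q) (m : ℕ) :
    (prefixNat δ m : ℝ) = (q : ℝ) ^ m * ∑ i ∈ Finset.range m, Real.ofDigitsTerm δ i := by
  have hq : (q : ℝ) ≠ 0 := by exact_mod_cast (δ 0).pos.ne'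
  induction m with
  | zero => simp [prefixNat]
  | succ m ih =>
    rw [Finset.sum_range_succ, prefixNat, Nat.cast_add, Nat.cast_mul, ih, Real.ofDigitsTerm]
    field_simp
    ring

theorem prefixNat_le {q : ℕ} (δ : ℕ → Fin q) (m : ℕ) :
    (prefixNat δ m : ℝ) ≤ (q : ℝ) ^ m * Real.ofDigits δ := by
  rw [prefixNat_eq_sum, Real.ofDigits_eq_sum_add_ofDigits δ m]
  refine mul_le_mul_of_nonneg_left ?_ (by positivity)
  have := Real.ofDigits_nonneg fun i => δ (i + m)
  have : 0 ≤ ((q : ℝ) ^ m)⁻¹ * Real.ofDigits fun i => δ (i + m) := by positivity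
  linarith

/-- The upper bound is attained when all further digits are `q - 1`. -/
theorem le_prefixNat_add_one {q : ℕ} (δ : ℕ → Fin q) (m : ℕ) :
    (q : ℝ) ^ m * Real.ofDigits δ ≤ prefixNat δ m + 1 := by
  have hq : (0 : ℝ) < (q : ℝ) ^ m := by
    have : (0 : ℝ) < q := by exact_mod_cast (δ 0).pos
    positivity
  rw [prefixNat_eq_sum, Real.ofDigits_eq_sum_add_ofDigits δ m, mul_add, ← mul_assoc,
    mul_inv_cancel₀ hq.ne', one_mul]
  gcongr
  exact Real.ofDigits_le_one _

/-- The decomposition of `{0, …, B - 1}` into maximal aligned intervals of length `q ^ e`: for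
each `e ≤ m` the intervals are those numbered by `q ⌊B / q ^ (e + 1)⌋ ≤ t < ⌊B / q ^ e⌋`. -/
theorem indicator_lt_eq_sum {q : ℕ} (hq : 0 < q) (A B m : ℕ) (hB : B < q ^ (m + 1)) :
    (if A < B then (1 : ℝ) else 0) =
      ∑ e ∈ Finset.range (m + 1), ∑ t ∈ Finset.Ico (q * (B / q ^ (e + 1))) (B / q ^ e),
        if A / q ^ e = t then (1 : ℝ) else 0 := by
  have hstep : ∀ e, ∑ t ∈ Finset.Ico (q * (B / q ^ (e + 1))) (B / q ^ e),
      (if A / q ^ e = t then (1 : ℝ) else 0) =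
      (if A / q ^ e < B / q ^ e then (1 : ℝ) else 0) -
        if A / q ^ (e + 1) < B / q ^ (e + 1) then (1 : ℝ) else 0 := by
    intro e
    have h1 : A / q ^ (e + 1) < B / q ^ (e + 1) ↔ A / q ^ e < q * (B / q ^ (e + 1)) := by
      rw [pow_succ, ← Nat.div_div_eq_div_mul A, Nat.div_lt_iff_lt_mul hq, mul_comm q]
    have h2 : q * (B / q ^ (e + 1)) ≤ B / q ^ e := by
      rw [pow_succ, ← Nat.div_div_eq_div_mul]
      exact Nat.mul_div_le _ _
    rw [Finset.sum_ite_eq]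
    simp only [Finset.mem_Ico, h1]
    generalize A / q ^ e = x, B / q ^ e = y, q * (B / q ^ (e + 1)) = z at h2 ⊢
    split_ifs <;> first | (exfalso; omega) | norm_num
  simp only [hstep]
  rw [Finset.sum_range_sub', Nat.div_eq_of_lt hB]
  simp

theorem cast_eq_sum_pow {q : ℕ} (B m : ℕ) (hB : B < q ^ (m + 1)) :
    (B : ℝ) = ∑ e ∈ Finset.range (m + 1),
      ∑ _t ∈ Finset.Ico (q * (B / q ^ (e + 1))) (B / q ^ e), (q : ℝ) ^ e := by
  have hstep : ∀ e, ∑ _t ∈ Finset.Ico (q * (B / q ^ (e + 1))) (B / q ^ e), (q : ℝ) ^ e =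
      ((B / q ^ e : ℕ) : ℝ) * (q : ℝ) ^ e -
        ((B / q ^ (e + 1) : ℕ) : ℝ) * (q : ℝ) ^ (e + 1) := by
    intro e
    have h2 : q * (B / q ^ (e + 1)) ≤ B / q ^ e := by
      rw [pow_succ, ← Nat.div_div_eq_div_mul]
      exact Nat.mul_div_le _ _
    rw [Finset.sum_const, Nat.card_Ico, nsmul_eq_mul, Nat.cast_sub h2]
    push_cast
    ring
  simp only [hstep]
  rw [Finset.sum_range_sub', Nat.div_eq_of_lt hB]
  simp

theorem card_Ico_div_le {q : ℕ} (hq : 0 < q) (B e : ℕ) :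
    (Finset.Ico (q * (B / q ^ (e + 1))) (B / q ^ e)).card ≤ q := by
  rw [Nat.card_Ico, pow_succ, ← Nat.div_div_eq_div_mul]
  have := Nat.mod_add_div (B / q ^ e) q
  have := Nat.mod_lt (B / q ^ e) hq
  omega

/-- If every elementary box with sides `q ^ (-d i)`, `d i ≤ m`, contains `q ^ m` times its volume
many points up to `ε d`, then so does every box with corners in `q ^ (-m) ℤ`, up to the sum of all
these errors times `q ^ s`. -/
theorem abs_card_prefixNat_lt_sub_le {q s m : ℕ} (hq : 2 ≤ q) {P : Type*} [Fintype P]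
    (δ : P → Fin s → ℕ → Fin q) (ε : (Fin s → ℕ) → ℝ)
    (hε : ∀ d : Fin s → ℕ, (∀ i, d i ≤ m) → ∀ τ : Fin s → ℕ → Fin q,
      |(Nat.card {l : P // ∀ i, ∀ j < d i, δ l i j = τ i j} : ℝ) -
        (q : ℝ) ^ m / (q : ℝ) ^ ∑ i, d i| ≤ ε d)
    (B : Fin s → ℕ) (hB : ∀ i, B i ≤ q ^ m) :
    |(Nat.card {l : P // ∀ i, prefixNat (δ l i) m < B i} : ℝ) -
        (q : ℝ) ^ m * ∏ i, ((B i : ℝ) / (q : ℝ) ^ m)| ≤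
      (q : ℝ) ^ s * ∑ e ∈ Fintype.piFinset fun _ : Fin s => Finset.range (m + 1),
        ε fun i => m - e i := by
  classical
  have hq0 : 0 < q := by omega
  have hq0' : (q : ℝ) ≠ 0 := by exact_mod_cast hq0.ne'
  have hB' : ∀ i, B i < q ^ (m + 1) := fun i =>
    (hB i).trans_lt (Nat.pow_lt_pow_right (by omega) (by omega))
  set I : Fin s → ℕ → Finset ℕ := fun i e =>
    Finset.Ico (q * (B i / q ^ (e + 1))) (B i / q ^ e) with hI
  have hcount : (Nat.card {l : P // ∀ i, prefixNat (δ l i) m < B i} : ℝ) =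
      ∑ e ∈ Fintype.piFinset fun _ : Fin s => Finset.range (m + 1),
        ∑ t ∈ Fintype.piFinset fun i => I i (e i),
          (Nat.card {l : P // ∀ i, prefixNat (δ l i) m / q ^ e i = t i} : ℝ) := by
    have h1 : ∀ (p : P → Fin s → Prop) [∀ l i, Decidable (p l i)],
        (Nat.card {l : P // ∀ i, p l i} : ℝ) = ∑ l : P, ∏ i, if p l i then (1 : ℝ) else 0 := by
      intro p _
      rw [Nat.card_eq_fintype_card, Fintype.card_subtype, ← Finset.sum_boole]
      refine Finset.sum_congr rfl fun l _ => ?_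
      rw [Finset.prod_ite_zero]
      simp
    rw [h1 fun l i => prefixNat (δ l i) m < B i]
    simp only [fun e t : Fin s → ℕ => h1 fun l i => prefixNat (δ l i) m / q ^ e i = t i]
    have h3 : ∀ l : P, (∏ i, if prefixNat (δ l i) m < B i then (1 : ℝ) else 0) =
        ∑ e ∈ Fintype.piFinset fun _ : Fin s => Finset.range (m + 1),
        ∑ t ∈ Fintype.piFinset fun i => I i (e i),
          ∏ i, if prefixNat (δ l i) m / q ^ e i = t i then (1 : ℝ) else 0 := by
      intro l
      simp only [fun i => indicator_lt_eq_sum hq0 (prefixNat (δ l i) m) (B i) m (hB' i)]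
      rw [Finset.prod_univ_sum]
      exact Finset.sum_congr rfl fun e _ => Finset.prod_univ_sum _ _
    simp only [h3]
    rw [Finset.sum_comm]
    exact Finset.sum_congr rfl fun e _ => Finset.sum_comm
  have hvol : (q : ℝ) ^ m * ∏ i, ((B i : ℝ) / (q : ℝ) ^ m) =
      ∑ e ∈ Fintype.piFinset fun _ : Fin s => Finset.range (m + 1),
        ∑ t ∈ Fintype.piFinset fun i => I i (e i),
          (q : ℝ) ^ m / (q : ℝ) ^ ∑ i, (m - e i) := by
    have h1 : ∀ i, (B i : ℝ) / (q : ℝ) ^ m =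
        ∑ e ∈ Finset.range (m + 1), ∑ _t ∈ I i e, ((q : ℝ) ^ (m - e))⁻¹ := by
      intro i
      rw [cast_eq_sum_pow (B i) m (hB' i), Finset.sum_div]
      refine Finset.sum_congr rfl fun e he => ?_
      rw [Finset.sum_div]
      refine Finset.sum_congr rfl fun t _ => ?_
      have he' : e ≤ m := by
        have := Finset.mem_range.1 he
        omega
      rw [pow_sub₀ _ hq0' he', div_eq_mul_inv, mul_inv, inv_inv, mul_comm]
    simp only [h1]
    rw [Finset.prod_univ_sum, Finset.mul_sum]
    refine Finset.sum_congr rfl fun e _ => ?_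
    rw [Finset.prod_univ_sum, Finset.mul_sum]
    refine Finset.sum_congr rfl fun t _ => ?_
    rw [Finset.prod_inv_distrib, Finset.prod_pow_eq_pow_sum, div_eq_mul_inv]
  rw [hcount, hvol, ← Finset.sum_sub_distrib, Finset.mul_sum]
  refine (Finset.abs_sum_le_sum_abs _ _).trans (Finset.sum_le_sum fun e he => ?_)
  have he' : ∀ i, e i ≤ m := fun i => by
    have := Finset.mem_range.1 (Fintype.mem_piFinset.1 he i)
    omega
  have hε0 : 0 ≤ ε fun i => m - e i :=
    (abs_nonneg _).trans (hε _ (fun i => Nat.sub_le _ _) fun _ _ => ⟨0, hq0⟩)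
  rw [← Finset.sum_sub_distrib]
  have hterm : ∀ t ∈ Fintype.piFinset fun i => I i (e i),
      |(Nat.card {l : P // ∀ i, prefixNat (δ l i) m / q ^ e i = t i} : ℝ) -
        (q : ℝ) ^ m / (q : ℝ) ^ ∑ i, (m - e i)| ≤ ε fun i => m - e i := by
    intro t ht
    have htlt : ∀ i, t i < q ^ (m - e i) := by
      intro i
      have h1 := (Finset.mem_Ico.1 (Fintype.mem_piFinset.1 ht i)).2
      refine h1.trans_le ?_
      rw [Nat.div_le_iff_le_mul_add_pred (by positivity), ← pow_add, Nat.add_sub_cancel' (he' i)]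
      exact (hB i).trans (Nat.le_add_right _ _)
    choose τ hτ using fun i => exists_prefixNat_eq_iff hq0 (m - e i) (t i) (htlt i)
    have h2 := hε (fun i => m - e i) (fun i => Nat.sub_le _ _) τ
    have h3 : Nat.card {l : P // ∀ i, prefixNat (δ l i) m / q ^ e i = t i} =
        Nat.card {l : P // ∀ i, ∀ j < m - e i, δ l i j = τ i j} := by
      refine Nat.card_congr (Equiv.subtypeEquivRight fun l => forall_congr' fun i => ?_)
      rw [← hτ i]
      have h4 := prefixNat_add_div (δ l i) (m - e i) (e i)
      rw [Nat.sub_add_cancel (he' i)] at h4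
      rw [h4]
    rw [h3]
    exact h2
  refine (Finset.abs_sum_le_sum_abs _ _).trans ((Finset.sum_le_sum hterm).trans ?_)
  rw [Finset.sum_const, nsmul_eq_mul]
  refine mul_le_mul_of_nonneg_right ?_ hε0
  have h5 : (Fintype.piFinset fun i => I i (e i)).card ≤ q ^ s := by
    rw [Fintype.card_piFinset]
    refine (Finset.prod_le_pow_card _ _ q fun i _ => card_Ico_div_le hq0 _ _).trans_eq ?_
    simp
  exact_mod_cast h5

theorem abs_prod_sub_prod_le {ι : Type*} (S : Finset ι) (a b : ι → ℝ) {η : ℝ}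
    (ha : ∀ i, a i ∈ Set.Icc (0 : ℝ) 1) (hb : ∀ i, b i ∈ Set.Icc (0 : ℝ) 1)
    (hab : ∀ i, |a i - b i| ≤ η) :
    |∏ i ∈ S, a i - ∏ i ∈ S, b i| ≤ S.card * η := by
  classical
  induction S using Finset.induction_on with
  | empty => simp
  | insert i S hi ih =>
    rw [Finset.prod_insert hi, Finset.prod_insert hi, Finset.card_insert_of_notMem hi]
    have h1 : a i * ∏ j ∈ S, a j - b i * ∏ j ∈ S, b j =
        a i * (∏ j ∈ S, a j - ∏ j ∈ S, b j) + (a i - b i) * ∏ j ∈ S, b j := by ring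
    have h2 : 0 ≤ ∏ j ∈ S, b j := Finset.prod_nonneg fun j _ => (hb j).1
    have h3 : ∏ j ∈ S, b j ≤ 1 := Finset.prod_le_one (fun j _ => (hb j).1) fun j _ => (hb j).2
    have h4 := ha i
    have h5 := hab i
    rw [h1]
    refine (abs_add_le _ _).trans ?_
    rw [abs_mul, abs_mul, abs_of_nonneg h4.1, abs_of_nonneg h2]
    push_cast
    have h6 := mul_le_mul h4.2 ih (abs_nonneg _) zero_le_one
    have h7 := mul_le_mul h5 h3 h2 ((abs_nonneg _).trans h5)
    linarith

/-- Passage from boxes with corners in `q ^ (-m) ℤ` to arbitrary boxes. A point whose digits from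
position `m` on are all `q - 1` lies on the right boundary of its elementary interval, whence the
inner approximation stays one further unit `q ^ (-m)` away from the boundary. -/
theorem abs_card_ofDigits_mem_sub_le {q s m : ℕ} (hq : 2 ≤ q) {P : Type*} [Finite P]
    (δ : P → Fin s → ℕ → Fin q) (E : ℝ)
    (hE : ∀ B : Fin s → ℕ, (∀ i, B i ≤ q ^ m) →
      |(Nat.card {l : P // ∀ i, prefixNat (δ l i) m < B i} : ℝ) -
        (q : ℝ) ^ m * ∏ i, ((B i : ℝ) / (q : ℝ) ^ m)| ≤ E)
    (a : Fin s → ℝ) (ha : ∀ i, a i ∈ Set.Icc (0 : ℝ) 1) :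
    |(Nat.card {l : P // ∀ i, Real.ofDigits (δ l i) ∈ Set.Ico 0 (a i)} : ℝ) -
        (q : ℝ) ^ m * ∏ i, a i| ≤ E + 2 * s := by
  have hqm : (0 : ℝ) < (q : ℝ) ^ m := by
    have : (0 : ℝ) < q := by exact_mod_cast (by omega : 0 < q)
    positivity
  have hnn : ∀ i, 0 ≤ (q : ℝ) ^ m * a i := fun i => mul_nonneg hqm.le (ha i).1
  have hfl1 : ∀ i, (⌊(q : ℝ) ^ m * a i⌋₊ : ℝ) ≤ (q : ℝ) ^ m * a i := fun i => Nat.floor_le (hnn i)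
  have hfl2 : ∀ i, (q : ℝ) ^ m * a i < ⌊(q : ℝ) ^ m * a i⌋₊ + 1 := fun i => Nat.lt_floor_add_one _
  have hle : ∀ i, (q : ℝ) ^ m * a i ≤ (q : ℝ) ^ m := fun i => by
    nlinarith [(ha i).2]
  set U : Fin s → ℕ := fun i => min (⌊(q : ℝ) ^ m * a i⌋₊ + 1) (q ^ m) with hU
  set V : Fin s → ℕ := fun i => ⌊(q : ℝ) ^ m * a i⌋₊ - 1 with hV
  have hU1 : ∀ i, U i ≤ q ^ m := fun i => min_le_right _ _
  have hV1 : ∀ i, V i ≤ q ^ m := fun i => by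
    have h1 : (⌊(q : ℝ) ^ m * a i⌋₊ : ℝ) ≤ ((q ^ m : ℕ) : ℝ) := by
      push_cast
      exact (hfl1 i).trans (hle i)
    have h2 : ⌊(q : ℝ) ^ m * a i⌋₊ ≤ q ^ m := by exact_mod_cast h1
    exact (Nat.sub_le _ _).trans h2
  have hcardU : Nat.card {l : P // ∀ i, Real.ofDigits (δ l i) ∈ Set.Ico 0 (a i)} ≤
      Nat.card {l : P // ∀ i, prefixNat (δ l i) m < U i} := by
    refine Nat.card_le_card_of_injective
      (Subtype.map id fun l hl i => lt_min ?_ (prefixNat_lt _ _))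
      (Subtype.map_injective _ Function.injective_id)
    have h1 : (prefixNat (δ l i) m : ℝ) < (q : ℝ) ^ m * a i :=
      (prefixNat_le _ _).trans_lt (mul_lt_mul_of_pos_left (hl i).2 hqm)
    exact_mod_cast h1.trans (hfl2 i)
  have hcardV : Nat.card {l : P // ∀ i, prefixNat (δ l i) m < V i} ≤
      Nat.card {l : P // ∀ i, Real.ofDigits (δ l i) ∈ Set.Ico 0 (a i)} := by
    refine Nat.card_le_card_of_injective
      (Subtype.map id fun l hl i => ⟨Real.ofDigits_nonneg _, ?_⟩)
      (Subtype.map_injective _ Function.injective_id)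
    have h1 : prefixNat (δ l i) m + 1 < ⌊(q : ℝ) ^ m * a i⌋₊ := by
      have := hl i
      simp only [hV] at this
      omega
    have h2 : (prefixNat (δ l i) m : ℝ) + 1 < ⌊(q : ℝ) ^ m * a i⌋₊ := by exact_mod_cast h1
    exact lt_of_mul_lt_mul_left
      ((le_prefixNat_add_one (δ l i) m).trans_lt (h2.trans_le (hfl1 i))) hqm.le
  have hvol : ∀ W : Fin s → ℕ, (∀ i, W i ≤ q ^ m) →
      (∀ i, |(W i : ℝ) - (q : ℝ) ^ m * a i| ≤ 2) →
      |(q : ℝ) ^ m * ∏ i, ((W i : ℝ) / (q : ℝ) ^ m) - (q : ℝ) ^ m * ∏ i, a i| ≤ 2 * s := by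
    intro W hW1 hW2
    have h1 := abs_prod_sub_prod_le Finset.univ (fun i => (W i : ℝ) / (q : ℝ) ^ m) a
      (η := 2 / (q : ℝ) ^ m)
      (fun i => ⟨by positivity, (div_le_one hqm).2 (by exact_mod_cast hW1 i)⟩) ha
      (fun i => by
        rw [le_div_iff₀ hqm, ← abs_of_pos hqm, ← abs_mul, abs_of_pos hqm, sub_mul,
          div_mul_cancel₀ _ hqm.ne', mul_comm (a i)]
        exact hW2 i)
    rw [← mul_sub, abs_mul, abs_of_pos hqm]
    refine (mul_le_mul_of_nonneg_left h1 hqm.le).trans_eq ?_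
    rw [Finset.card_univ, Fintype.card_fin]
    field_simp
  have hUvol := hvol U hU1 fun i => by
    have h1 : (U i : ℝ) ≤ ⌊(q : ℝ) ^ m * a i⌋₊ + 1 := by
      have : U i ≤ ⌊(q : ℝ) ^ m * a i⌋₊ + 1 := min_le_left _ _
      exact_mod_cast this
    have h2 : (q : ℝ) ^ m * a i ≤ U i := by
      simp only [hU]
      push_cast
      exact le_min (hfl2 i).le (hle i)
    have := hfl1 i
    exact abs_le.2 ⟨by linarith, by linarith⟩
  have hVvol := hvol V hV1 fun i => by
    have h1 : (⌊(q : ℝ) ^ m * a i⌋₊ : ℝ) ≤ V i + 1 := by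
      exact_mod_cast (by simp only [hV]; omega : ⌊(q : ℝ) ^ m * a i⌋₊ ≤ V i + 1)
    have h2 : (V i : ℝ) ≤ ⌊(q : ℝ) ^ m * a i⌋₊ := Nat.cast_le.2 (Nat.sub_le _ _)
    have := hfl1 i
    have := hfl2 i
    exact abs_le.2 ⟨by linarith, by linarith⟩
  have hUE := hE U hU1
  have hVE := hE V hV1
  have h1 : (Nat.card {l : P // ∀ i, Real.ofDigits (δ l i) ∈ Set.Ico 0 (a i)} : ℝ) ≤
      Nat.card {l : P // ∀ i, prefixNat (δ l i) m < U i} := by exact_mod_cast hcardU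
  have h2 : (Nat.card {l : P // ∀ i, prefixNat (δ l i) m < V i} : ℝ) ≤
      Nat.card {l : P // ∀ i, Real.ofDigits (δ l i) ∈ Set.Ico 0 (a i)} := by exact_mod_cast hcardV
  rw [abs_le] at hUE hVE hUvol hVvol ⊢
  exact ⟨by linarith, by linarith⟩

end Digits

/-! ### Discrepancy of hyperplane sequences in terms of the numbers of solutions -/

section Discrepancy

/-- The sum over all elementary shapes, with sides `q ^ (-(m - e i))`, of the expected number of
points in a box of that shape times the number of nonzero solutions that disturb it. -/
def defect {F : Type*} [Field F] [Fintype F] {s : ℕ} (α : Fin s → PowerSeries F) (m : ℕ) : ℝ :=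
  ∑ e ∈ Fintype.piFinset fun _ : Fin s => Finset.range (m + 1),
    (Fintype.card F : ℝ) ^ m / (Fintype.card F : ℝ) ^ (∑ i, (m - e i)) *
      ((Nat.card (solutions α m fun i => m - e i) : ℝ) - 1)

variable {F : Type*} [Field F]

theorem outputDigit_eq_sum {q : ℕ} [NeZero q] (hq : 2 ≤ q) {φ : Fin q ≃ F} (hφ : φ 0 = 0)
    (C : Matrix ℕ ℕ F) {k R : ℕ} (hk : k < q ^ R) (j : ℕ) :
    outputDigit φ C k j = ∑ r ∈ Finset.range R, C j r * φ (Fin.ofNat q (k / q ^ r)) := by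
  have hlen : (Nat.digits q k).length ≤ R := (Nat.digits_length_le_iff (by omega) k).2 hk
  refine Finset.sum_subset (Finset.range_mono hlen) fun r _ hr => ?_
  have h1 : k < q ^ r := by
    refine (Nat.lt_base_pow_length_digits (b := q) (by omega)).trans_le ?_
    exact Nat.pow_le_pow_right (by omega) (not_lt.1 fun h => hr (Finset.mem_range.2 h))
  rw [Nat.div_eq_of_lt h1]
  have h2 : Fin.ofNat q 0 = 0 := rfl
  rw [h2, hφ, mul_zero]

/-- Within a block `A q ^ m ≤ k < (A + 1) q ^ m` the output digits depend affinely on the lowest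
`m` digits of `k`. -/
theorem outputDigit_block {q : ℕ} [NeZero q] (hq : 2 ≤ q) {φ : Fin q ≃ F} (hφ : φ 0 = 0)
    (C : Matrix ℕ ℕ F) (A m j : ℕ) {l : ℕ} (hl : l < q ^ m) :
    outputDigit φ C (A * q ^ m + l) j =
      ∑ r : Fin m, C j r * φ (Fin.ofNat q (l / q ^ (r : ℕ))) +
        ∑ r ∈ Finset.range A, C j (m + r) * φ (Fin.ofNat q (A / q ^ r)) := by
  have hq0 : 0 < q := by omega
  have hA : A + 1 ≤ q ^ A := Nat.lt_pow_self (by omega)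
  have hk : A * q ^ m + l < q ^ (m + A) := by
    rw [pow_add]
    have := Nat.mul_le_mul_left (q ^ m) hA
    nlinarith
  rw [outputDigit_eq_sum hq hφ C hk, Finset.sum_range_add]
  congr 1
  · rw [Finset.sum_range]
    refine Finset.sum_congr rfl fun r _ => ?_
    congr 2
    have h1 : A * q ^ m = q ^ (r : ℕ) * (q * (A * q ^ (m - r - 1))) := by
      have h2 : q ^ m = q ^ (r : ℕ) * q * q ^ (m - r - 1) := by
        rw [← pow_succ, ← pow_add]
        congr 1
        omega
      rw [h2]
      ring
    rw [h1, Nat.mul_add_div (by positivity)]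
    exact Fin.ext (Nat.mul_add_mod _ _ _)
  · refine Finset.sum_congr rfl fun r _ => ?_
    rw [pow_add, ← Nat.div_div_eq_div_mul, mul_comm A, Nat.mul_add_div (by positivity),
      Nat.div_eq_of_lt hl, add_zero]

theorem rowSpace_eq_orth_dualSpace {s : ℕ} {𝔅 : NestedBases F s} {α : Fin s → PowerSeries F}
    {C : Fin s → Matrix ℕ ℕ F} (hC : IsHyperplaneGenerating 𝔅 α C) (m : ℕ) :
    rowSpace C m = orth (dualSpace 𝔅 α m) := by
  rcases Nat.eq_zero_or_pos m with rfl | hm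
  · exact Subsingleton.elim _ _
  · exact hC m hm

theorem abs_card_block_sub_le [Fintype F] {q s : ℕ} [NeZero q] (hq : 2 ≤ q)
    (hF : Fintype.card F = q) {φ : Fin q ≃ F} (hφ : φ 0 = 0) {𝔅 : NestedBases F s}
    {α : Fin s → PowerSeries F} {C : Fin s → Matrix ℕ ℕ F} (hC : IsHyperplaneGenerating 𝔅 α C)
    (A m : ℕ) (a : Fin s → ℝ) (ha : ∀ i, a i ∈ Set.Icc (0 : ℝ) 1) :
    |(Nat.card {l : Fin (q ^ m) //
        ∀ i, digitalSequence φ C (A * q ^ m + l) i ∈ Set.Ico 0 (a i)} : ℝ) -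
      (q : ℝ) ^ m * ∏ i, a i| ≤ (q : ℝ) ^ s * defect α m + 2 * s := by
  refine abs_card_ofDigits_mem_sub_le hq
    (fun (l : Fin (q ^ m)) i j => φ.symm (outputDigit φ (C i) (A * q ^ m + l) j)) _ ?_ a ha
  refine fun B hB => (abs_card_prefixNat_lt_sub_le hq _ (fun d => (q : ℝ) ^ m /
    (q : ℝ) ^ (∑ i, d i) * ((Nat.card (solutions α m d) : ℝ) - 1)) ?_ B hB).trans_eq ?_
  · intro d hd τ
    let G : Matrix (Σ i, Fin (d i)) (Fin m) F := Matrix.of fun p r => C p.1 p.2 r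
    let c : (Σ i, Fin (d i)) → F := fun p => φ (τ p.1 p.2) -
      ∑ r ∈ Finset.range A, C p.1 p.2 (m + r) * φ (Fin.ofNat q (A / q ^ r))
    let ψ : Fin (q ^ m) ≃ (Fin m → F) :=
      finFunctionFinEquiv.symm.trans (Equiv.arrowCongr (Equiv.refl _) φ)
    have hψ : ∀ l r, ψ l r = φ (Fin.ofNat q ((l : ℕ) / q ^ (r : ℕ))) := fun l r => rfl
    have hcard : Nat.card {l : Fin (q ^ m) // ∀ i, ∀ j < d i,
        φ.symm (outputDigit φ (C i) (A * q ^ m + l) j) = τ i j} =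
        Nat.card {x : Fin m → F // G.mulVec x = c} := by
      refine Nat.card_congr (ψ.subtypeEquiv fun l => ?_)
      have h1 : ∀ i j, φ.symm (outputDigit φ (C i) (A * q ^ m + l) j) = τ i j ↔
          ∑ r : Fin m, C i j r * ψ l r = φ (τ i j) -
            ∑ r ∈ Finset.range A, C i j (m + r) * φ (Fin.ofNat q (A / q ^ r)) := by
        intro i j
        rw [Equiv.symm_apply_eq, outputDigit_block hq hφ _ _ _ _ l.2, eq_sub_iff_add_eq]
        simp only [hψ]
      simp only [h1]
      constructor
      · intro h
        ext ⟨i, j⟩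
        exact h i j j.2
      · intro h i j hj
        exact congrFun h ⟨i, j, hj⟩
    rw [hcard]
    have h2 := abs_card_solutions_sub_le G c
    have h3 : Nat.card {u : (Σ i, Fin (d i)) → F // Matrix.vecMul u G = 0} ≤
        Nat.card (solutions α m d) :=
      card_leftKer_le (rowSpace_eq_orth_dualSpace hC m) hd
    have h4 : (Nat.card {u : (Σ i, Fin (d i)) → F // Matrix.vecMul u G = 0} : ℝ) ≤
        Nat.card (solutions α m d) := by exact_mod_cast h3
    rw [Fintype.card_sigma, hF] at h2
    simp only [Fintype.card_fin] at h2
    refine h2.trans (mul_le_mul_of_nonneg_left ?_ (by positivity))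
    linarith
  · rw [defect, hF]

/-- Decomposition of `[A q ^ n, A q ^ n + N)`, `N < q ^ n`, into aligned blocks, at most `q` of
each length `q ^ m`. -/
theorem abs_sum_range_le_of_blocks {q : ℕ} (hq : 0 < q) (g : ℕ → ℝ) (E : ℕ → ℝ)
    (hE : ∀ m A, |∑ l ∈ Finset.range (q ^ m), g (A * q ^ m + l)| ≤ E m) (n : ℕ) :
    ∀ A N : ℕ, N < q ^ n →
      |∑ l ∈ Finset.range N, g (A * q ^ n + l)| ≤ q * ∑ m ∈ Finset.range n, E m := by
  induction n with
  | zero =>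
    intro A N hN
    have : N = 0 := by simpa using hN
    simp [this]
  | succ n ih =>
    intro A N hN
    have hqn : 0 < q ^ n := by positivity
    have hν : N / q ^ n < q := by
      rw [Nat.div_lt_iff_lt_mul hqn, ← pow_succ']
      exact hN
    have hblocks : ∀ ν : ℕ,
        |∑ l ∈ Finset.range (ν * q ^ n), g (A * q ^ (n + 1) + l)| ≤ ν * E n := by
      intro ν
      induction ν with
      | zero => simp
      | succ ν ihν =>
        rw [Nat.succ_mul, Finset.sum_range_add]
        refine (abs_add_le _ _).trans ?_
        have h1 := hE n (A * q + ν)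
        have h2 : ∀ l, A * q ^ (n + 1) + (ν * q ^ n + l) = (A * q + ν) * q ^ n + l := by
          intro l
          ring
        simp only [h2]
        push_cast
        linarith
    have h3 := ih (A * q + N / q ^ n) (N % q ^ n) (Nat.mod_lt _ hqn)
    have h4 : ∀ l, A * q ^ (n + 1) + (N / q ^ n * q ^ n + l) =
        (A * q + N / q ^ n) * q ^ n + l := by
      intro l
      ring
    have h5 : N = N / q ^ n * q ^ n + N % q ^ n := (Nat.div_add_mod' N (q ^ n)).symm
    have hE0 : 0 ≤ E n := (abs_nonneg _).trans (hE n 0)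
    have h6 : ((N / q ^ n : ℕ) : ℝ) * E n ≤ q * E n := by
      refine mul_le_mul_of_nonneg_right ?_ hE0
      exact_mod_cast hν.le
    rw [h5, Finset.sum_range_add, Finset.sum_range_succ, mul_add]
    refine (abs_add_le _ _).trans ?_
    simp only [h4]
    have h7 := hblocks (N / q ^ n)
    linarith

theorem starDiscrepancy_le [Fintype F] {q s : ℕ} [NeZero q] (hq : 2 ≤ q)
    (hF : Fintype.card F = q) {φ : Fin q ≃ F} (hφ : φ 0 = 0) {𝔅 : NestedBases F s}
    {α : Fin s → PowerSeries F} {x : ℕ → Fin s → ℝ} (hx : IsHyperplaneSequence φ 𝔅 α x)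
    {N n : ℕ} (hN : 0 < N) (hn : N < q ^ n) :
    starDiscrepancy x N ≤
      q * (∑ m ∈ Finset.range n, ((q : ℝ) ^ s * defect α m + 2 * s)) / N := by
  classical
  obtain ⟨C, hC, rfl⟩ := hx
  have hN' : (0 : ℝ) < N := by exact_mod_cast hN
  have hne : Nonempty (Fin s → Set.Icc (0 : ℝ) 1) := ⟨fun _ => ⟨0, by simp⟩⟩
  refine ciSup_le fun a => ?_
  set p : ℕ → Prop := fun k => ∀ i, digitalSequence φ C k i ∈ Set.Ico 0 (a i : ℝ) with hp
  set v : ℝ := ∏ i, (a i : ℝ) with hv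
  have hmain := abs_sum_range_le_of_blocks (by omega : 0 < q)
    (fun k => (if p k then (1 : ℝ) else 0) - v) (fun m => (q : ℝ) ^ s * defect α m + 2 * s)
    (fun m A => by
      have h1 := abs_card_block_sub_le hq hF hφ hC A m (fun i => (a i : ℝ)) fun i => (a i).2
      convert h1 using 2
      rw [Finset.sum_sub_distrib, Finset.sum_const, Finset.card_range, nsmul_eq_mul,
        Finset.sum_range fun l => if p (A * q ^ m + l) then (1 : ℝ) else 0, Finset.sum_boole,
        Nat.card_eq_fintype_card, Fintype.card_subtype]
      push_cast
      rfl) n 0 N hn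
  have hcount : (boxCount (digitalSequence φ C) N (fun i => (a i : ℝ)) : ℝ) =
      ∑ k ∈ Finset.range N, if p k then (1 : ℝ) else 0 := by
    rw [Finset.sum_boole, boxCount, ← Set.ncard_coe_finset]
    congr 2
    ext k
    simp [hp]
  rw [hcount, div_sub' hN'.ne', abs_div, abs_of_pos hN']
  refine div_le_div_of_nonneg_right ?_ hN'.le
  simp only [zero_mul, zero_add] at hmain
  rwa [Finset.sum_sub_distrib, Finset.sum_const, Finset.card_range, nsmul_eq_mul] at hmain

end Discrepancy

/-! ### The average number of solutions -/

section Average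

variable {F : Type*} [Field F] {s : ℕ}

/-- The tuple of power series with constant coefficient `1`, first component `1`, and the other
coefficients of the components given by `γ`. -/
def unitSeries (γ : ℕ → Fin s → F) (i : Fin s) : PowerSeries F :=
  if (i : ℕ) = 0 then 1 else 1 + PowerSeries.X * PowerSeries.mk fun r => γ r i

theorem coeff_succ_unitSeries (γ : ℕ → Fin s → F) {i : Fin s} (hi : (i : ℕ) ≠ 0) (r : ℕ) :
    PowerSeries.coeff (r + 1) (unitSeries γ i) = γ r i := by
  rw [unitSeries, if_neg hi, map_add, PowerSeries.coeff_succ_X_mul, PowerSeries.coeff_mk,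
    PowerSeries.coeff_one, if_neg (Nat.succ_ne_zero r), zero_add]

theorem coeff_zero_unitSeries (γ : ℕ → Fin s → F) (i : Fin s) :
    PowerSeries.coeff 0 (unitSeries γ i) = 1 := by
  rw [unitSeries]
  split_ifs <;> simp

theorem unitSeries_mem_YTilde (γ : ℕ → Fin s → F) : unitSeries γ ∈ YTilde F s := by
  refine ⟨fun i m hm => ?_, fun i hi => if_pos hi⟩
  refine IsCoprime.pow_right ((Polynomial.irreducible_X.coprime_iff_not_dvd).2 ?_).symm
  rw [Polynomial.X_dvd_iff, PowerSeries.coeff_trunc, if_pos (by omega), coeff_zero_unitSeries]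
  exact one_ne_zero

theorem zero_mem_solutions (α : Fin s → PowerSeries F) (m : ℕ) (d : Fin s → ℕ) :
    0 ∈ solutions α m d := by
  change (PowerSeries.X : PowerSeries F) ^ m ∣ _
  simp [polyOf]

theorem solutions_unitSeries_congr {γ γ' : ℕ → Fin s → F} {m : ℕ} (h : ∀ r < m, γ r = γ' r)
    (d : Fin s → ℕ) : solutions (unitSeries γ) m d = solutions (unitSeries γ') m d := by
  ext k
  refine dvd_iff_dvd_of_dvd_sub ?_
  rw [← Finset.sum_sub_distrib]
  refine Finset.dvd_sum fun i _ => ?_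
  rw [← sub_mul]
  refine Dvd.dvd.mul_right (PowerSeries.X_pow_dvd_iff.2 fun r hr => ?_) _
  rw [map_sub, sub_eq_zero]
  cases r with
  | zero => rw [coeff_zero_unitSeries, coeff_zero_unitSeries]
  | succ r =>
    by_cases hi : (i : ℕ) = 0
    · rw [unitSeries, unitSeries, if_pos hi, if_pos hi]
    · rw [coeff_succ_unitSeries γ hi, coeff_succ_unitSeries γ' hi, h r (by omega)]

/-- A set of vectors over a `q`-element alphabet in which `n` of the coordinates are determined by
the others is smaller than the whole space by a factor of at least `q ^ n`. -/
theorem card_mul_pow_le {F : Type*} [Fintype F] {ι : Type*} [Fintype ι] {n : ℕ} (g : Fin n ↪ ι)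
    (S : Set (ι → F))
    (hS : ∀ x ∈ S, ∀ y ∈ S, (∀ p, p ∉ Set.range g → x p = y p) → x = y) :
    Nat.card S * Fintype.card F ^ n ≤ Fintype.card F ^ Fintype.card ι := by
  classical
  have h1 : Nat.card (S × (Fin n → F)) ≤ Nat.card ((↥(Set.range g)ᶜ → F) × (Fin n → F)) := by
    refine Nat.card_le_card_of_injective
      (fun z => (fun p => z.1.1 p.1, z.2)) fun z w hzw => ?_
    have h2 := Prod.ext_iff.1 hzw
    refine Prod.ext (Subtype.ext (hS _ z.1.2 _ w.1.2 fun p hp => ?_)) h2.2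
    exact congrFun h2.1 ⟨p, hp⟩
  have h3 : Fintype.card ↥(Set.range g)ᶜ + n = Fintype.card ι := by
    have h4 := Fintype.card_compl_set (Set.range g)
    have h5 := Set.card_range_of_injective g.injective
    have h6 := Fintype.card_le_of_embedding g
    rw [Fintype.card_fin] at h5 h6
    omega
  rw [Nat.card_prod, Nat.card_prod] at h1
  simp only [Nat.card_eq_fintype_card, Fintype.card_fun, Fintype.card_fin] at h1 ⊢
  rwa [← pow_add, h3] at h1

/-- Extension by zero of the first `M` coefficients of `s` power series. -/
def extendCoeffs {M : ℕ} (β : Fin M × Fin s → F) (r : ℕ) (i : Fin s) : F :=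
  if h : r < M then β (⟨r, h⟩, i) else 0

/-- If `k i` has order exactly `v` for some `i ≠ 0`, then the congruence `α · k ≡ 0 (mod x ^ m)`
determines `α i` modulo `x ^ (m - v)`, once the other components are given. -/
theorem card_unitSeries_mul_pow_le [Fintype F] {M m : ℕ} (hM : m ≤ M) {d : Fin s → ℕ}
    (k : (Σ i, Fin (d i)) → F) {i : Fin s} (hi : (i : ℕ) ≠ 0) (v : Fin (d i)) (hv : (v : ℕ) < m)
    (hk : k ⟨i, v⟩ ≠ 0) (hk0 : ∀ j < v, k ⟨i, j⟩ = 0) :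
    Nat.card {β : Fin M × Fin s → F | k ∈ solutions (unitSeries (extendCoeffs β)) m d} *
      Fintype.card F ^ (m - v - 1) ≤ Fintype.card F ^ (M * s) := by
  have hcard : Fintype.card (Fin M × Fin s) = M * s := by simp
  rw [← hcard]
  have hle : m - v - 1 ≤ M := by omega
  refine card_mul_pow_le ⟨fun r => (Fin.castLE hle r, i), fun r r' h =>
    Fin.castLE_injective hle (Prod.ext_iff.1 h).1⟩ _ fun β hβ β' hβ' hag => ?_
  have hag' : ∀ (r : Fin M) (l : Fin s), (l = i → m - v - 1 ≤ (r : ℕ)) → β (r, l) = β' (r, l) := by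
    intro r l h
    refine hag _ ?_
    rintro ⟨t, ht⟩
    have h1 := Prod.ext_iff.1 ht
    have h2 := h h1.2.symm
    have h3 : (t : ℕ) = r := congrArg Fin.val h1.1
    omega
  set γ := extendCoeffs β with hγ
  set γ' := extendCoeffs β' with hγ'
  have hother : ∀ l ≠ i, unitSeries γ l = unitSeries γ' l := by
    intro l hl
    have h1 : (fun r => γ r l) = fun r => γ' r l := by
      ext r
      simp only [hγ, hγ', extendCoeffs]
      split_ifs with h
      · exact hag' _ l fun h => absurd h hl
      · rfl
    rw [unitSeries, unitSeries, h1]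
  have hdvd : (PowerSeries.X : PowerSeries F) ^ m ∣
      (unitSeries γ i - unitSeries γ' i) * (polyOf d k i : F[X]) := by
    have h1 := dvd_sub (show (PowerSeries.X : PowerSeries F) ^ m ∣ _ from hβ)
      (show (PowerSeries.X : PowerSeries F) ^ m ∣ _ from hβ')
    rw [← Finset.sum_sub_distrib, Finset.sum_eq_single i] at h1
    · rwa [← sub_mul] at h1
    · intro l _ hl
      rw [hother l hl, sub_self]
    · simp
  obtain ⟨w, hw⟩ : (PowerSeries.X : PowerSeries F) ^ (v : ℕ) ∣
      ((polyOf d k i : F[X]) : PowerSeries F) := by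
    rw [PowerSeries.X_pow_dvd_iff]
    intro r hr
    rw [Polynomial.coeff_coe, coeff_polyOf, dif_pos (hr.trans v.2)]
    exact hk0 ⟨r, hr.trans v.2⟩ hr
  have hwu : IsUnit w := by
    rw [PowerSeries.isUnit_iff_constantCoeff, isUnit_iff_ne_zero]
    have h1 : PowerSeries.coeff (v : ℕ) ((polyOf d k i : F[X]) : PowerSeries F) = k ⟨i, v⟩ := by
      rw [Polynomial.coeff_coe, coeff_polyOf, dif_pos v.2]
    rw [hw, PowerSeries.coeff_X_pow_mul', if_pos le_rfl, Nat.sub_self,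
      PowerSeries.coeff_zero_eq_constantCoeff_apply] at h1
    rwa [h1]
  have hdvd' : (PowerSeries.X : PowerSeries F) ^ (m - v) ∣ unitSeries γ i - unitSeries γ' i := by
    rw [hw, mul_left_comm, ← Nat.add_sub_cancel' hv.le, pow_add,
      mul_dvd_mul_iff_left (pow_ne_zero _ PowerSeries.X_ne_zero), hwu.dvd_mul_right] at hdvd
    simpa using hdvd
  ext ⟨r, l⟩
  by_cases hrl : l = i → m - v - 1 ≤ (r : ℕ)
  · exact hag' r l hrl
  · push Not at hrl
    obtain ⟨rfl, hr⟩ := hrl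
    have h1 := PowerSeries.X_pow_dvd_iff.1 hdvd' (r + 1) (by omega)
    rw [map_sub, sub_eq_zero, coeff_succ_unitSeries γ hi, coeff_succ_unitSeries γ' hi] at h1
    simpa [hγ, hγ', extendCoeffs] using h1

theorem card_vanishing_mul_pow_le [Fintype F] {d : Fin s → ℕ} (i : Fin s) (v : Fin (d i)) :
    Nat.card {k : (Σ i, Fin (d i)) → F | ∀ j < v, k ⟨i, j⟩ = 0} * Fintype.card F ^ (v : ℕ) ≤
      Fintype.card F ^ ∑ i, d i := by
  have hcard : Fintype.card (Σ i, Fin (d i)) = ∑ i, d i := by simp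
  rw [← hcard]
  refine card_mul_pow_le ⟨fun j => ⟨i, Fin.castLE v.2.le j⟩, fun j j' h =>
    Fin.castLE_injective v.2.le (by simpa using h)⟩ _ fun k hk k' hk' hag => ?_
  ext ⟨l, j⟩
  by_cases h : (⟨l, j⟩ : Σ i, Fin (d i)) ∈ Set.range fun t : Fin (v : ℕ) =>
      (⟨i, Fin.castLE v.2.le t⟩ : Σ i, Fin (d i))
  · obtain ⟨t, ht⟩ := h
    rw [← ht, hk _ t.2, hk' _ t.2]
  · exact hag _ h

/-- As the first component of `unitSeries γ` is `1`, a nonzero solution of small degree cannot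
vanish in all other components. -/
theorem exists_order_of_mem_solutions {γ : ℕ → Fin s → F} {m : ℕ} {d : Fin s → ℕ}
    (hd : ∀ i, d i ≤ m) {k : (Σ i, Fin (d i)) → F} (hk : k ∈ solutions (unitSeries γ) m d)
    (hk0 : k ≠ 0) :
    ∃ i : Fin s, (i : ℕ) ≠ 0 ∧ ∃ v : Fin (d i), k ⟨i, v⟩ ≠ 0 ∧ ∀ j < v, k ⟨i, j⟩ = 0 := by
  have hex : ∃ i : Fin s, (i : ℕ) ≠ 0 ∧ ∃ v : Fin (d i), k ⟨i, v⟩ ≠ 0 := by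
    by_contra! hall
    apply hk0
    ext ⟨i, j⟩
    by_cases hi : (i : ℕ) = 0
    · have h1 : (PowerSeries.X : PowerSeries F) ^ m ∣
          ∑ i, unitSeries γ i * (polyOf d k i : F[X]) := hk
      rw [Finset.sum_eq_single i, unitSeries, if_pos hi, one_mul] at h1
      · have h2 := PowerSeries.X_pow_dvd_iff.1 h1 j (j.2.trans_le (hd i))
        rwa [Polynomial.coeff_coe, coeff_polyOf, dif_pos j.2] at h2
      · intro l _ hl
        have h3 : polyOf d k l = 0 := by
          refine Finset.sum_eq_zero fun t _ => ?_
          rw [hall l (fun h => hl (Fin.ext (h.trans hi.symm))) t, map_zero]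
        rw [h3, Polynomial.coe_zero, mul_zero]
      · simp
    · exact hall i hi j
  obtain ⟨i, hi, hv⟩ := hex
  refine ⟨i, hi, ?_⟩
  obtain ⟨v, hv1, hv2⟩ := WellFounded.has_min wellFounded_lt {v : Fin (d i) | k ⟨i, v⟩ ≠ 0} hv
  exact ⟨v, hv1, fun j hj => by_contra fun h => hv2 j h hj⟩

/-- On average over the first `M ≥ m` coefficients of `α`, the number of nonzero solutions exceeds
the expected value `q ^ (∑ d - m)` by a factor of at most `s m q`. -/
theorem sum_card_solutions_sub_one_le [Fintype F] {M m : ℕ} (hM : m ≤ M) {d : Fin s → ℕ}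
    (hd : ∀ i, d i ≤ m) :
    ∑ β : Fin M × Fin s → F,
        ((Nat.card (solutions (unitSeries (extendCoeffs β)) m d) : ℝ) - 1) ≤
      s * m * Fintype.card F * ((Fintype.card F : ℝ) ^ (∑ i, d i) / (Fintype.card F : ℝ) ^ m) *
        (Fintype.card F : ℝ) ^ (M * s) := by
  classical
  have hq : (0 : ℝ) < Fintype.card F := by exact_mod_cast Fintype.card_pos
  set Q : ℝ := (Fintype.card F : ℝ) with hQ
  let sol : (Fin M × Fin s → F) → Set ((Σ i, Fin (d i)) → F) :=
    fun β => solutions (unitSeries (extendCoeffs β)) m d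
  have h1 : ∀ β, (Nat.card (sol β) : ℝ) - 1 =
      ∑ k ∈ Finset.univ.erase 0, if k ∈ sol β then (1 : ℝ) else 0 := by
    intro β
    have h2 : (Nat.card (sol β) : ℝ) = ∑ k, if k ∈ sol β then (1 : ℝ) else 0 := by
      rw [Finset.sum_boole, Nat.card_eq_fintype_card, ← Set.toFinset_card]
      congr 2
      ext k
      simp
    rw [h2, ← Finset.add_sum_erase _ _ (Finset.mem_univ 0), if_pos (zero_mem_solutions _ _ _)]
    ring
  have h2 : ∀ k, ∑ β, (if k ∈ sol β then (1 : ℝ) else 0) = Nat.card {β | k ∈ sol β} := by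
    intro k
    rw [Finset.sum_boole, Nat.card_eq_fintype_card, ← Set.toFinset_card]
    congr 2
    ext β
    simp
  change ∑ β, ((Nat.card (sol β) : ℝ) - 1) ≤ _
  simp only [h1]
  rw [Finset.sum_comm]
  simp only [h2]
  -- Each `k` is counted at the order of one of its components.
  have h3 : ∀ k ∈ Finset.univ.erase (0 : (Σ i, Fin (d i)) → F),
      (Nat.card {β | k ∈ sol β} : ℝ) ≤ ∑ p : Σ i, Fin (d i),
        if ∀ j < p.2, k ⟨p.1, j⟩ = 0 then Q ^ (M * s) / Q ^ (m - p.2 - 1) else 0 := by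
    intro k hk
    have hnn : ∀ p ∈ (Finset.univ : Finset (Σ i, Fin (d i))), (0 : ℝ) ≤
        if ∀ j < p.2, k ⟨p.1, j⟩ = 0 then Q ^ (M * s) / Q ^ (m - p.2 - 1) else 0 := by
      intro p _
      split_ifs <;> positivity
    rcases Set.eq_empty_or_nonempty {β | k ∈ sol β} with he | ⟨β, hβ⟩
    · rw [he]
      simpa using Finset.sum_nonneg hnn
    · obtain ⟨i, hi, v, hv, hv0⟩ :=
        exists_order_of_mem_solutions hd hβ (Finset.ne_of_mem_erase hk)
      refine le_trans ?_ (Finset.single_le_sum hnn (Finset.mem_univ ⟨i, v⟩))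
      rw [if_pos hv0, le_div_iff₀ (by positivity)]
      have h4 : Nat.card {β | k ∈ sol β} * Fintype.card F ^ (m - v - 1) ≤
          Fintype.card F ^ (M * s) :=
        card_unitSeries_mul_pow_le hM k hi v (v.2.trans_le (hd i)) hv hv0
      rw [hQ]
      exact_mod_cast h4
  have h4 : ∀ p : Σ i, Fin (d i), (∑ k : (Σ i, Fin (d i)) → F,
      if ∀ j < p.2, k ⟨p.1, j⟩ = 0 then Q ^ (M * s) / Q ^ (m - p.2 - 1) else 0) ≤
        Q * (Q ^ (∑ i, d i) / Q ^ m) * Q ^ (M * s) := by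
    rintro ⟨i, v⟩
    have hv : (v : ℕ) < m := v.2.trans_le (hd i)
    have h5 := card_vanishing_mul_pow_le (F := F) i v
    have hfilter : Nat.card {k : (Σ i, Fin (d i)) → F | ∀ j < v, k ⟨i, j⟩ = 0} =
        (Finset.univ.filter fun k : (Σ i, Fin (d i)) → F => ∀ j < v, k ⟨i, j⟩ = 0).card := by
      rw [Nat.card_eq_fintype_card, ← Set.toFinset_card]
      congr 1
      ext k
      simp
    rw [hfilter] at h5
    have h6 : ((Finset.univ.filter fun k : (Σ i, Fin (d i)) → F =>
        ∀ j < v, k ⟨i, j⟩ = 0).card : ℝ) * Q ^ (v : ℕ) ≤ Q ^ ∑ i, d i := by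
      rw [hQ]
      exact_mod_cast h5
    rw [← Finset.sum_filter, Finset.sum_const, nsmul_eq_mul]
    have h7 : Q ^ m = Q ^ (v : ℕ) * Q ^ (m - v - 1) * Q := by
      rw [← pow_add, ← pow_succ]
      congr 1
      omega
    rw [← le_div_iff₀ (by positivity)] at h6
    refine (mul_le_mul_of_nonneg_right h6 (by positivity)).trans_eq ?_
    rw [h7]
    field_simp
  calc ∑ k ∈ Finset.univ.erase 0, (Nat.card {β | k ∈ sol β} : ℝ)
      ≤ ∑ k ∈ Finset.univ.erase (0 : (Σ i, Fin (d i)) → F), ∑ p : Σ i, Fin (d i),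
        (if ∀ j < p.2, k ⟨p.1, j⟩ = 0 then Q ^ (M * s) / Q ^ (m - p.2 - 1) else 0) :=
        Finset.sum_le_sum h3
    _ ≤ ∑ k : (Σ i, Fin (d i)) → F, ∑ p : Σ i, Fin (d i),
        (if ∀ j < p.2, k ⟨p.1, j⟩ = 0 then Q ^ (M * s) / Q ^ (m - p.2 - 1) else 0) := by
        refine Finset.sum_le_sum_of_subset_of_nonneg (Finset.subset_univ _) fun k _ _ => ?_
        refine Finset.sum_nonneg fun p _ => ?_
        split_ifs <;> positivity
    _ ≤ ∑ p : Σ i, Fin (d i), Q * (Q ^ (∑ i, d i) / Q ^ m) * Q ^ (M * s) := by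
        rw [Finset.sum_comm]
        exact Finset.sum_le_sum fun p _ => h4 p
    _ ≤ s * m * Q * (Q ^ (∑ i, d i) / Q ^ m) * Q ^ (M * s) := by
        rw [Finset.sum_const, nsmul_eq_mul, Finset.card_univ, Fintype.card_sigma]
        simp only [Fintype.card_fin, mul_assoc]
        rw [← mul_assoc (s : ℝ)]
        refine mul_le_mul_of_nonneg_right ?_ (by positivity)
        have h5 : ∑ i, d i ≤ s * m := by
          refine (Finset.sum_le_card_nsmul _ _ m fun i _ => hd i).trans_eq ?_
          simp
        exact_mod_cast h5

theorem defect_nonneg [Fintype F] (α : Fin s → PowerSeries F) (m : ℕ) : 0 ≤ defect α m := by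
  refine Finset.sum_nonneg fun e _ => mul_nonneg (by positivity) (sub_nonneg.2 ?_)
  have h1 : Nonempty (solutions α m fun i => m - e i) := ⟨⟨0, zero_mem_solutions _ _ _⟩⟩
  exact_mod_cast (Nat.card_pos : 0 < Nat.card (solutions α m fun i => m - e i))

theorem sum_defect_le [Fintype F] {M m : ℕ} (hM : m ≤ M) :
    ∑ β : Fin M × Fin s → F, defect (unitSeries (extendCoeffs β)) m ≤
      (m + 1) ^ s * (s * m * Fintype.card F) * (Fintype.card F : ℝ) ^ (M * s) := by
  have hq : (0 : ℝ) < Fintype.card F := by exact_mod_cast Fintype.card_pos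
  simp only [defect]
  rw [Finset.sum_comm]
  have h1 : ∀ e ∈ Fintype.piFinset fun _ : Fin s => Finset.range (m + 1),
      ∑ β : Fin M × Fin s → F,
        (Fintype.card F : ℝ) ^ m / (Fintype.card F : ℝ) ^ (∑ i, (m - e i)) *
          ((Nat.card (solutions (unitSeries (extendCoeffs β)) m fun i => m - e i) : ℝ) - 1) ≤
      s * m * Fintype.card F * (Fintype.card F : ℝ) ^ (M * s) := by
    intro e _
    rw [← Finset.mul_sum]
    refine (mul_le_mul_of_nonneg_left (sum_card_solutions_sub_one_le hM
      fun i => Nat.sub_le m (e i)) (by positivity)).trans_eq ?_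
    field_simp
  refine (Finset.sum_le_card_nsmul _ _ _ h1).trans_eq ?_
  rw [Fintype.card_piFinset_const, Finset.card_range, nsmul_eq_mul]
  push_cast
  ring

end Average

/-! ### Choice of the power series -/

section Choice

/-- The weight with which the defect at level `m` enters into the choice of the power series. -/
def weight (s m : ℕ) : ℝ := 1 / ((m + 3 : ℝ) ^ (s + 2) * Real.log (m + 3) ^ 2)

theorem log_add_three_pos (m : ℕ) : 0 < Real.log (m + 3 : ℝ) :=
  Real.log_pos (by linarith [(Nat.cast_nonneg m : (0 : ℝ) ≤ m)])

theorem weight_pos (s m : ℕ) : 0 < weight s m := by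
  have := log_add_three_pos m
  unfold weight
  positivity

/-- The series `∑ 1 / (n log² n)` is majorized by the telescoping series of the differences of
`1 / log n`. -/
theorem sum_inv_mul_log_sq_le (M : ℕ) :
    ∑ m ∈ Finset.range M, 1 / ((m + 3 : ℝ) * Real.log (m + 3) ^ 2) ≤ 2 := by
  have h1 : ∀ m : ℕ, 1 / ((m + 3 : ℝ) * Real.log (m + 3) ^ 2) ≤
      1 / Real.log (m + 2) - 1 / Real.log ((m + 1 : ℕ) + 2) := by
    intro m
    have hm : (0 : ℝ) ≤ m := Nat.cast_nonneg m
    have hcast : ((m + 1 : ℕ) + 2 : ℝ) = m + 3 := by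
      push_cast
      ring
    rw [hcast]
    have ha : 0 < Real.log (m + 2 : ℝ) := Real.log_pos (by linarith)
    have hb : 0 < Real.log (m + 3 : ℝ) := log_add_three_pos m
    have hab : Real.log (m + 2 : ℝ) ≤ Real.log (m + 3) :=
      Real.log_le_log (by linarith) (by linarith)
    have hdiff : 1 / (m + 3 : ℝ) ≤ Real.log (m + 3) - Real.log (m + 2) := by
      rw [← Real.log_div (by positivity) (by positivity)]
      refine le_trans (le_of_eq ?_) (Real.one_sub_inv_le_log_of_pos (by positivity))
      field_simp
      ring
    rw [div_sub_div _ _ ha.ne' hb.ne', one_mul, mul_one, ← div_div]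
    refine div_le_div₀ (by linarith [(by positivity : 0 ≤ 1 / (m + 3 : ℝ))]) hdiff
      (by positivity) ?_
    rw [sq]
    exact mul_le_mul_of_nonneg_right hab hb.le
  refine (Finset.sum_le_sum fun m _ => h1 m).trans ?_
  rw [Finset.sum_range_sub' fun m : ℕ => 1 / Real.log ((m : ℝ) + 2)]
  have h2 : 0 ≤ 1 / Real.log ((M : ℝ) + 2) :=
    one_div_nonneg.2 (Real.log_nonneg (by linarith [(Nat.cast_nonneg M : (0 : ℝ) ≤ M)]))
  have h3 : 1 / Real.log ((0 : ℕ) + 2 : ℝ) ≤ 2 := by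
    rw [Nat.cast_zero, zero_add, div_le_iff₀ (by linarith [Real.log_two_gt_d9])]
    linarith [Real.log_two_gt_d9]
  linarith

variable {F : Type*} [Field F] [Fintype F] {s : ℕ}

theorem exists_coeffs_sum_weight_mul_defect_le (M : ℕ) :
    ∃ γ : ℕ → Fin s → F, ∑ m ∈ Finset.range M, weight s m * defect (unitSeries γ) m ≤
      2 * s * Fintype.card F := by
  classical
  have hq : (0 : ℝ) < Fintype.card F := by exact_mod_cast Fintype.card_pos
  have havg : ∑ β : Fin M × Fin s → F,
      ∑ m ∈ Finset.range M, weight s m * defect (unitSeries (extendCoeffs β)) m ≤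
      ∑ _β : Fin M × Fin s → F, 2 * s * (Fintype.card F : ℝ) := by
    rw [Finset.sum_comm, Finset.sum_const, Finset.card_univ, nsmul_eq_mul]
    simp only [Fintype.card_fun, Fintype.card_prod, Fintype.card_fin]
    have h1 : ∀ m ∈ Finset.range M,
        ∑ β : Fin M × Fin s → F, weight s m * defect (unitSeries (extendCoeffs β)) m ≤
        1 / ((m + 3 : ℝ) * Real.log (m + 3) ^ 2) *
          (s * Fintype.card F * (Fintype.card F : ℝ) ^ (M * s)) := by
      intro m hm
      have hlog := log_add_three_pos m
      rw [← Finset.mul_sum]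
      refine (mul_le_mul_of_nonneg_left (sum_defect_le (Finset.mem_range.1 hm).le)
        (weight_pos s m).le).trans ?_
      have h2 : (m + 1 : ℝ) ^ s * m ≤ (m + 3) ^ s * (m + 3) := by
        gcongr <;> linarith
      have h3 : weight s m * ((m + 1 : ℝ) ^ s * (s * m * Fintype.card F) *
          (Fintype.card F : ℝ) ^ (M * s)) = weight s m * ((m + 1 : ℝ) ^ s * m) *
          (s * Fintype.card F * (Fintype.card F : ℝ) ^ (M * s)) := by ring
      rw [h3]
      refine mul_le_mul_of_nonneg_right ?_ (by positivity)
      refine (mul_le_mul_of_nonneg_left h2 (weight_pos s m).le).trans_eq ?_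
      unfold weight
      field_simp
      ring
    refine (Finset.sum_le_sum h1).trans ?_
    rw [← Finset.sum_mul]
    refine (mul_le_mul_of_nonneg_right (sum_inv_mul_log_sq_le M) (by positivity)).trans_eq ?_
    push_cast
    ring
  obtain ⟨β, _, hβ⟩ := Finset.exists_le_of_sum_le
    (Finset.univ_nonempty (α := Fin M × Fin s → F)) havg
  exact ⟨extendCoeffs β, hβ⟩

/-- A compactness argument turns the choices for all finite levels into a single one. -/
theorem exists_coeffs_forall_sum_weight_mul_defect_le :
    ∃ γ : ℕ → Fin s → F, ∀ M : ℕ,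
      ∑ m ∈ Finset.range M, weight s m * defect (unitSeries γ) m ≤ 2 * s * Fintype.card F := by
  choose f hf using fun M => exists_coeffs_sum_weight_mul_defect_le (F := F) (s := s) M
  let _ : TopologicalSpace F := ⊥
  have _ : DiscreteTopology F := ⟨rfl⟩
  obtain ⟨γ, φ, hφ, hγ⟩ := CompactSpace.tendsto_subseq f
  refine ⟨γ, fun M => ?_⟩
  have hev : ∀ r, ∀ᶠ n in Filter.atTop, f (φ n) r = γ r := by
    intro r
    have h1 := (tendsto_pi_nhds.1 hγ) r
    rw [nhds_discrete, Filter.tendsto_pure] at h1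
    exact h1
  have hall : ∀ᶠ n in Filter.atTop, ∀ r ∈ Finset.range M, f (φ n) r = γ r :=
    (Filter.eventually_all_finset _).2 fun r _ => hev r
  obtain ⟨n, hn, hnM⟩ := (hall.and (Filter.eventually_ge_atTop M)).exists
  have hMn : M ≤ φ n := hnM.trans (hφ.id_le n)
  have hcongr : ∀ m ∈ Finset.range M,
      weight s m * defect (unitSeries γ) m = weight s m * defect (unitSeries (f (φ n))) m := by
    intro m hm
    have h1 : ∀ r < m, γ r = f (φ n) r := fun r hr =>
      (hn r (Finset.mem_range.2 (hr.trans (Finset.mem_range.1 hm)))).symm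
    simp only [defect, solutions_unitSeries_congr h1]
  rw [Finset.sum_congr rfl hcongr]
  refine le_trans ?_ (hf (φ n))
  exact Finset.sum_le_sum_of_subset_of_nonneg (Finset.range_mono hMn) fun m _ _ =>
    mul_nonneg (weight_pos s m).le (defect_nonneg _ _)

end Choice

/-! ### The final estimate -/

section Final

theorem one_le_log_of_three_le {x : ℝ} (hx : 3 ≤ x) : 1 ≤ Real.log x := by
  rw [Real.le_log_iff_exp_le (by linarith)]
  linarith [Real.exp_one_lt_d9]

theorem log_log_three_pos : 0 < Real.log (Real.log 3) := by
  refine Real.log_pos ?_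
  rw [Real.lt_log_iff_exp_lt (by norm_num)]
  linarith [Real.exp_one_lt_d9]

theorem sum_defect_range_le {F : Type*} [Field F] [Fintype F] {s : ℕ} {γ : ℕ → Fin s → F}
    (hγ : ∀ M : ℕ, ∑ m ∈ Finset.range M, weight s m * defect (unitSeries γ) m ≤
      2 * s * Fintype.card F) (n : ℕ) :
    ∑ m ∈ Finset.range n, defect (unitSeries γ) m ≤
      2 * s * Fintype.card F * ((n + 2 : ℝ) ^ (s + 2) * Real.log (n + 2) ^ 2) := by
  have h1 : ∀ m ∈ Finset.range n, defect (unitSeries γ) m ≤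
      weight s m * defect (unitSeries γ) m *
        ((n + 2 : ℝ) ^ (s + 2) * Real.log (n + 2) ^ 2) := by
    intro m hm
    have hmn : (m + 3 : ℝ) ≤ n + 2 := by
      have : m + 3 ≤ n + 2 := by
        have := Finset.mem_range.1 hm
        omega
      exact_mod_cast this
    have hm0 : (0 : ℝ) ≤ m := Nat.cast_nonneg m
    have hlog := log_add_three_pos m
    have h2 : 1 ≤ weight s m * ((n + 2 : ℝ) ^ (s + 2) * Real.log (n + 2) ^ 2) := by
      rw [weight, one_div_mul_eq_div, one_le_div (by positivity)]
      have := Real.log_le_log (by linarith) hmn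
      gcongr
    have h3 := mul_le_mul_of_nonneg_left h2 (defect_nonneg (unitSeries γ) m)
    linarith
  refine (Finset.sum_le_sum h1).trans ?_
  rw [← Finset.sum_mul]
  exact mul_le_mul_of_nonneg_right (hγ n) (by positivity)

theorem log_bound {s q N : ℕ} (hs : 2 ≤ s) (hq : 2 ≤ q) (hN : 3 ≤ N) :
    ((Nat.log q N + 1 : ℕ) + 2 : ℝ) ^ (s + 2) * Real.log ((Nat.log q N + 1 : ℕ) + 2) ^ 2 ≤
      5 ^ (s + 2) * (Real.log 5 / Real.log (Real.log 3) + 1) ^ 2 *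
        (Real.log N ^ (2 * s) * Real.log (Real.log N) ^ 2) := by
  have hN3 : (3 : ℝ) ≤ N := by exact_mod_cast hN
  have hL1 : 1 ≤ Real.log N := one_le_log_of_three_le hN3
  have hll : Real.log (Real.log 3) ≤ Real.log (Real.log N) :=
    Real.log_le_log (by linarith [one_le_log_of_three_le le_rfl])
      (Real.log_le_log (by norm_num) hN3)
  have hpow : ((q : ℝ) ^ Nat.log q N) ≤ N := by
    exact_mod_cast Nat.pow_log_le_self q (by omega)
  have h1 : (Nat.log q N : ℝ) * Real.log q ≤ Real.log N := by
    rw [← Real.log_pow]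
    exact Real.log_le_log (by positivity) hpow
  have h2 : (1 / 2 : ℝ) ≤ Real.log q := by
    have h3 : Real.log 2 ≤ Real.log q := Real.log_le_log (by norm_num) (by exact_mod_cast hq)
    linarith [Real.log_two_gt_d9]
  have h4 : ((Nat.log q N + 1 : ℕ) + 2 : ℝ) ≤ 5 * Real.log N := by
    push_cast
    have h5 : (Nat.log q N : ℝ) * (1 / 2) ≤ Nat.log q N * Real.log q :=
      mul_le_mul_of_nonneg_left h2 (Nat.cast_nonneg _)
    linarith
  have hn0 : (0 : ℝ) ≤ (Nat.log q N + 1 : ℕ) := Nat.cast_nonneg _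
  have h6 : Real.log ((Nat.log q N + 1 : ℕ) + 2) ≤
      (Real.log 5 / Real.log (Real.log 3) + 1) * Real.log (Real.log N) := by
    refine (Real.log_le_log (by linarith) h4).trans ?_
    rw [Real.log_mul (by norm_num) (by linarith), add_mul, one_mul]
    have h7 : Real.log 5 ≤ Real.log 5 / Real.log (Real.log 3) * Real.log (Real.log N) := by
      rw [div_mul_eq_mul_div, le_div_iff₀ log_log_three_pos]
      exact mul_le_mul_of_nonneg_left hll (Real.log_nonneg (by norm_num))
    linarith
  have h8 : 0 ≤ Real.log ((Nat.log q N + 1 : ℕ) + 2 : ℝ) := Real.log_nonneg (by linarith)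
  calc ((Nat.log q N + 1 : ℕ) + 2 : ℝ) ^ (s + 2) * Real.log ((Nat.log q N + 1 : ℕ) + 2) ^ 2
      ≤ (5 * Real.log N) ^ (s + 2) *
        ((Real.log 5 / Real.log (Real.log 3) + 1) * Real.log (Real.log N)) ^ 2 := by
        gcongr
    _ = 5 ^ (s + 2) * (Real.log 5 / Real.log (Real.log 3) + 1) ^ 2 *
        (Real.log N ^ (s + 2) * Real.log (Real.log N) ^ 2) := by ring
    _ ≤ _ := by
        gcongr
        omega

end Final

end HyperplaneSeq

theorem mainTheorem2 (s q : ℕ) [NeZero q] (hs : 2 ≤ s) (hq : IsPrimePow q) :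
    ∃ c : ℝ, ∀ (F : Type*) [Field F] [Fintype F], Fintype.card F = q →
      ∀ φ : Fin q ≃ F, φ 0 = 0 →
      ∀ 𝔅 : HyperplaneSeq.NestedBases F s,
      ∃ α ∈ HyperplaneSeq.YTilde F s,
        (∃ x : ℕ → Fin s → ℝ, HyperplaneSeq.IsHyperplaneSequence φ 𝔅 α x) ∧
        ∀ x : ℕ → Fin s → ℝ, HyperplaneSeq.IsHyperplaneSequence φ 𝔅 α x →
          ∀ N : ℕ, 3 ≤ N →
            HyperplaneSeq.starDiscrepancy x N ≤
              c * (Real.log N ^ (2 * s) * Real.log (Real.log N) ^ 2 / N) := by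
  have hq2 : 2 ≤ q := hq.two_le
  refine ⟨q * ((q : ℝ) ^ s * (2 * s * q) + 2 * s) *
    (5 ^ (s + 2) * (Real.log 5 / Real.log (Real.log 3) + 1) ^ 2), ?_⟩
  intro F _ _ hF φ hφ 𝔅
  obtain ⟨γ, hγ⟩ :=
    HyperplaneSeq.exists_coeffs_forall_sum_weight_mul_defect_le (F := F) (s := s)
  refine ⟨HyperplaneSeq.unitSeries γ, HyperplaneSeq.unitSeries_mem_YTilde γ, ?_, ?_⟩
  · obtain ⟨C, hC⟩ :=
      HyperplaneSeq.exists_isHyperplaneGenerating 𝔅 (HyperplaneSeq.unitSeries γ)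
    exact ⟨_, C, hC, rfl⟩
  intro x hx N hN
  have hN0 : (0 : ℝ) < N := by exact_mod_cast (by omega : 0 < N)
  refine (HyperplaneSeq.starDiscrepancy_le hq2 hF hφ hx (by omega)
    (Nat.lt_pow_succ_log_self (by omega) N)).trans ?_
  rw [← mul_div_assoc]
  refine div_le_div_of_nonneg_right ?_ hN0.le
  have hlog := HyperplaneSeq.log_bound hs hq2 hN
  set n := Nat.log q N + 1 with hn
  set W : ℝ := ((n : ℕ) + 2 : ℝ) ^ (s + 2) * Real.log ((n : ℕ) + 2) ^ 2 with hW
  have hsum := HyperplaneSeq.sum_defect_range_le hγ n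
  rw [hF, ← hW] at hsum
  have hnW : (n : ℝ) ≤ W := by
    have hn1 : (1 : ℝ) ≤ n := by exact_mod_cast (by omega : 1 ≤ n)
    have h1 : (1 : ℝ) ≤ Real.log ((n : ℝ) + 2) ^ 2 :=
      one_le_pow₀ (HyperplaneSeq.one_le_log_of_three_le (by linarith))
    have h2 : (n : ℝ) + 2 ≤ ((n : ℝ) + 2) ^ (s + 2) :=
      le_self_pow₀ (by linarith) (by omega)
    have h3 := mul_le_mul h2 h1 zero_le_one (by positivity)
    linarith
  rw [Finset.sum_add_distrib, ← Finset.mul_sum, Finset.sum_const, Finset.card_range, nsmul_eq_mul]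
  calc (q : ℝ) * ((q : ℝ) ^ s * ∑ m ∈ Finset.range n,
          HyperplaneSeq.defect (HyperplaneSeq.unitSeries γ) m + n * (2 * s))
      ≤ q * ((q : ℝ) ^ s * (2 * s * q * W) + W * (2 * s)) := by gcongr
    _ = q * ((q : ℝ) ^ s * (2 * s * q) + 2 * s) * W := by ring
    _ ≤ q * ((q : ℝ) ^ s * (2 * s * q) + 2 * s) * _ :=
        mul_le_mul_of_nonneg_left hlog (by positivity)
    _ = _ := by ring
end
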